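/- Fix integers $n\ge 0$ and $k\ge 2$. For $m\ge 0$ let $C(n,m)$ be the set of $m$-element subsets of $\{1,\dots,n\}$. For $X=\{x_1<\dots<x_{m+1}\}\in C(n,m+1)$ the $m$-packet of $X$ is $P_X=\{A\subset X: |A|=m\}$; its lexicographic order is $X\setminus x_{m+1}<\dots<X\setminus x_1$, and its antilexicographic order is the reverse. For $J\subseteq C(n,m)$ let $J_s$ (resp. $J_p$, $J_F$) be the set of $X\in C(n,m+1)$ for which $P_X\cap J$ is a nonempty proper suffix of $P_X$ in lexicographic order (resp. a nonempty proper prefix, all of $P_X$). $J$ is a realizable $m$-set if $P_X\cap J$ is a (possibly empty or full) prefix or suffix of $P_X$ for every $X\in C(n,m+1)$. For $J\subseteq C(n,m)$, a total order on $J$ is an admissible $J$-order if it induces on $P_X\cap J$ the antilexicographic order for $X\in J_s$, the lexicographic order for $X\in J_p$, and one of these two orders for $X\in J_F$. The inversion set of an admissible $J$-order is $J_s$ together with all $X\in J_F$ whose packet is ordered antilexicographically. Elementary equivalence is the equivalence relation generated by interchanging two neighbouring elements that do not lie in a common $m$-packet; $\pi$ denotes the passage to equivalence classes. Inversion sets depend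 only on the class. The second Bruhat order of $J$ is the set of classes of admissible $J$-orders, partially ordered by: $r\le r'$ if $r'$ is obtained from $r$ by a sequence of upward packet flips, where an upward flip picks $X\in J_F$ not in the inversion set and a representative in which $P_X$ is a contiguous block, and reverses that block. Let $J$ be a realizable $k$-set. Then: (1) $J_s$ and $J_s\cup J_F$ are realizable $(k+1)$-sets, and an admissible $J_s$-order exists. (2) Each maximal chain of the second Bruhat order of $J$ induces exactly one total order on $J_F$, in which $X$ precedes $Y$ if and only if some member of the chain has $X$ but not $Y$ in its inversion set. Let $\mathcal O_F$ be the set of total orders on $J_F$ so obtained. For an admissible $J_s$-order $\rho_s$ let $\mathcal O^{\rho_s}=\{\rho_s\rho_F:\rho_F\in\mathcal O_F\}$, where $\rho_s\rho_F$ is the order on $J_s\cup J_F$ that lists $J_s$ according to $\rho_s$ and then $J_F$ according to $\rho_F$. Let $\mathcal A_{S\le F}$ be the set of admissible $(J_s\cup J_F)$-orders in which every element of $J_s$ precedes every element of $J_F$. Then $\mathcal O^{\rho_s}\subseteq\mathcal A_{S\le F}$. (3) For all admissible $J_s$-orders $\rho_s,\rho_s'$ and every $\rho_F\in\mathcal O_F$,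 the orders $\rho_s\rho_F$ and $\rho_s'\rho_F$ are elementary equivalent; in particular $\pi(\mathcal O^{\rho_s})=\pi(\mathcal O^{\rho_s'})$. (4) For every admissible $J_s$-order $\rho_s$, $$\pi(\mathcal O^{\rho_s})=\pi(\mathcal A_{S\le F})$$ as subposets of the second Bruhat order of $J_s\cup J_F$. Hence the third Bruhat order of $J$, $B_3(J):=\pi(\mathcal A_{S\le F})$, is well defined and equals $\pi(\mathcal O^{\rho_s})$ for every choice of $\rho_s$. -/

import Mathlib

namespace HigherBruhat

/-- `C(n,k)`: the `k`-element subsets of an `n`-element totally ordered set. -/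
def C (n k : ℕ) : Finset (Finset (Fin n)) := Finset.powersetCard k Finset.univ

/-- The packet `P_X`: all subsets of `X` with exactly one element less than `X`. -/
def packet {n : ℕ} (X : Finset (Fin n)) : Finset (Finset (Fin n)) :=
  Finset.powersetCard (X.card - 1) X

/-- The packet of `X = {x₁ < ⋯ < x_m}` in antilexicographic order: `X∖x₁, X∖x₂, …, X∖x_m`. -/
def antiPacket {n : ℕ} (X : Finset (Fin n)) : List (Finset (Fin n)) :=
  (X.sort (· ≤ ·)).map X.erase

/-- The packet of `X = {x₁ < ⋯ < x_m}` in lexicographic order: `X∖x_m, …, X∖x₂, X∖x₁`. -/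
def lexPacket {n : ℕ} (X : Finset (Fin n)) : List (Finset (Fin n)) :=
  (antiPacket X).reverse

/-- Lexicographic comparison of two sets of the same size: the smallest element at which they
differ belongs to the smaller one. -/
def LexLt {n : ℕ} (A B : Finset (Fin n)) : Prop := ∃ a ∈ A \ B, ∀ b ∈ B \ A, a < b

theorem lexPacket_pairwise {n : ℕ} (X : Finset (Fin n)) : (lexPacket X).Pairwise LexLt := by
  unfold lexPacket antiPacket
  rw [List.pairwise_reverse, List.pairwise_map]
  have h : (X.sort (· ≤ ·)).Pairwise (· < ·) := Finset.sortedLT_sort X |>.pairwise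
  refine h.imp_of_mem ?_
  intro a b ha hb hab
  rw [Finset.mem_sort] at ha hb
  refine ⟨a, by simp [ha, hab.ne], ?_⟩
  intro c hc
  simp only [Finset.mem_sdiff, Finset.mem_erase] at hc
  have : c = b := by
    by_contra hne
    exact hc.2 ⟨hne, hc.1.2⟩
  exact this ▸ hab

theorem mem_antiPacket {n : ℕ} {X A : Finset (Fin n)} (hX : X.Nonempty) :
    A ∈ antiPacket X ↔ A ∈ packet X := by
  simp only [antiPacket, List.mem_map, Finset.mem_sort, packet, Finset.mem_powersetCard]
  constructor
  · rintro ⟨x, hx, rfl⟩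
    exact ⟨Finset.erase_subset _ _, Finset.card_erase_of_mem hx⟩
  · rintro ⟨hs, hc⟩
    have hpos := hX.card_pos
    have h1 : (X \ A).card = 1 := by
      rw [Finset.card_sdiff_of_subset hs]; omega
    obtain ⟨x, hx⟩ := Finset.card_eq_one.1 h1
    have hxm : x ∈ X \ A := by simp [hx]
    refine ⟨x, (Finset.mem_sdiff.1 hxm).1, ?_⟩
    rw [Finset.erase_eq, ← hx, Finset.sdiff_sdiff_eq_self hs]

theorem mem_lexPacket {n : ℕ} {X A : Finset (Fin n)} (hX : X.Nonempty) :
    A ∈ lexPacket X ↔ A ∈ packet X := by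
  rw [lexPacket, List.mem_reverse, mem_antiPacket hX]

/-- For a set `J` of `k`-sets, the intersection `P_X ∩ J`, listed lexicographically. -/
def inter {n : ℕ} (J : Finset (Finset (Fin n))) (X : Finset (Fin n)) : List (Finset (Fin n)) :=
  (lexPacket X).filter (· ∈ J)

/-- `J_s`: the `X` for which `P_X ∩ J` is a nonempty proper suffix of `P_X`. -/
def sufSet (n k : ℕ) (J : Finset (Finset (Fin n))) : Finset (Finset (Fin n)) :=
  (C n (k + 1)).filter fun X => inter J X <:+ lexPacket X ∧ inter J X ≠ [] ∧ inter J X ≠ lexPacket X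

/-- `J_p`: the `X` for which `P_X ∩ J` is a nonempty proper prefix of `P_X`. -/
def preSet (n k : ℕ) (J : Finset (Finset (Fin n))) : Finset (Finset (Fin n)) :=
  (C n (k + 1)).filter fun X => inter J X <+: lexPacket X ∧ inter J X ≠ [] ∧ inter J X ≠ lexPacket X

/-- `J_F`: the `X` for which `P_X ⊆ J`. -/
def fullSet (n k : ℕ) (J : Finset (Finset (Fin n))) : Finset (Finset (Fin n)) :=
  (C n (k + 1)).filter fun X => packet X ⊆ J

/-- A realizable `k`-set: a set `J ⊆ C(n,k)` meeting every `k`-packet in a (possibly empty or full)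
prefix or suffix of its lexicographic order. -/
def Realizable (n k : ℕ) (J : Finset (Finset (Fin n))) : Prop :=
  J ⊆ C n k ∧ ∀ X ∈ C n (k + 1), inter J X <+: lexPacket X ∨ inter J X <:+ lexPacket X

/-- `ρ` is an admissible `J`-order (`J ⊆ C(n,k)`). A total order on the finite set `J` is written as
the list of the elements of `J` in increasing order; the order it induces on `P_X ∩ J` is then a
filtered list. -/
structure IsAdm (n k : ℕ) (J : Finset (Finset (Fin n))) (ρ : List (Finset (Fin n))) : Prop where
  nodup : ρ.Nodup
  toFinset_eq : ρ.toFinset = J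
  suf : ∀ X ∈ sufSet n k J, ρ.filter (· ∈ packet X) = (inter J X).reverse
  pre : ∀ X ∈ preSet n k J, ρ.filter (· ∈ packet X) = inter J X
  full : ∀ X ∈ fullSet n k J,
    ρ.filter (· ∈ packet X) = lexPacket X ∨ ρ.filter (· ∈ packet X) = antiPacket X

/-- `A_J(n,k)`, the set of admissible `J`-orders. -/
def Adm (n k : ℕ) (J : Finset (Finset (Fin n))) : Type :=
  {ρ : List (Finset (Fin n)) // IsAdm n k J ρ}

/-- The inversion set of an order `ρ` on `J`. -/
def inv (n k : ℕ) (J : Finset (Finset (Fin n))) (ρ : List (Finset (Fin n))) :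
    Finset (Finset (Fin n)) :=
  sufSet n k J ∪ (fullSet n k J).filter fun X => ρ.filter (· ∈ packet X) = antiPacket X

/-- `A` and `B` lie in a common `k`-packet. -/
def SharePacket (n k : ℕ) (A B : Finset (Fin n)) : Prop :=
  ∃ X ∈ C n (k + 1), A ∈ packet X ∧ B ∈ packet X

/-- `ρ` and `ρ'` differ by interchanging two neighbours that share no `k`-packet. -/
def ElemEquiv (n k : ℕ) (J : Finset (Finset (Fin n))) (ρ ρ' : Adm n k J) : Prop :=
  ∃ a b A B, ¬ SharePacket n k A B ∧ ρ.1 = a ++ A :: B :: b ∧ ρ'.1 = a ++ B :: A :: b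

/-- The equivalence relation generated by elementary equivalences. -/
def admSetoid (n k : ℕ) (J : Finset (Finset (Fin n))) : Setoid (Adm n k J) :=
  Relation.EqvGen.setoid (ElemEquiv n k J)

/-- The second Bruhat order of `J ⊆ C(n,k)`: admissible `J`-orders up to elementary equivalence. -/
def SecondBruhat (n k : ℕ) (J : Finset (Finset (Fin n))) : Type := Quotient (admSetoid n k J)

/-- The quotient map `π`. -/
def proj {n k : ℕ} {J : Finset (Finset (Fin n))} (ρ : Adm n k J) : SecondBruhat n k J :=
  Quotient.mk (admSetoid n k J) ρ

theorem inv_eq_of_elemEquiv {n k : ℕ} {J : Finset (Finset (Fin n))} {ρ ρ' : Adm n k J}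
    (h : ElemEquiv n k J ρ ρ') : inv n k J ρ.1 = inv n k J ρ'.1 := by
  obtain ⟨a, b, A, B, hs, h1, h2⟩ := h
  unfold inv
  congr 1
  refine Finset.filter_congr fun X hX => ?_
  have hXC : X ∈ C n (k + 1) := (Finset.mem_filter.1 hX).1
  have : ρ.1.filter (· ∈ packet X) = ρ'.1.filter (· ∈ packet X) := by
    rw [h1, h2]
    by_cases hA : A ∈ packet X
    · have hB : B ∉ packet X := fun hB => hs ⟨X, hXC, hA, hB⟩
      simp [List.filter_append, hA, hB]
    · simp [List.filter_append, List.filter_cons, hA]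
  rw [this]

/-- The inversion set of a class of admissible `J`-orders. -/
def SecondBruhat.inv {n k : ℕ} {J : Finset (Finset (Fin n))} (r : SecondBruhat n k J) :
    Finset (Finset (Fin n)) :=
  Quotient.lift (fun ρ : Adm n k J => HigherBruhat.inv n k J ρ.1) (by
    intro ρ ρ' h
    change Relation.EqvGen _ ρ ρ' at h
    induction h with
    | rel _ _ h => exact inv_eq_of_elemEquiv h
    | refl _ => rfl
    | symm _ _ _ ih => exact ih.symm
    | trans _ _ _ _ _ ih1 ih2 => exact ih1.trans ih2) r

/-- `r'` is obtained from `r` by an upward packet flip: for some `X ∈ J_F` outside the inversion set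
of `r`, some representative of `r` contains `P_X` as a contiguous block in lexicographic order, and
reversing that block gives a representative of `r'`. -/
def FlipUp {n k : ℕ} {J : Finset (Finset (Fin n))} (r r' : SecondBruhat n k J) : Prop :=
  ∃ (ρ ρ' : Adm n k J) (X : Finset (Fin n)) (a b : List (Finset (Fin n))),
    r = proj ρ ∧ r' = proj ρ' ∧ X ∈ fullSet n k J ∧ X ∉ r.inv ∧
    ρ.1 = a ++ lexPacket X ++ b ∧ ρ'.1 = a ++ antiPacket X ++ b

theorem filter_packet_short {n k : ℕ} {X Y : Finset (Fin n)} (hX : X ∈ C n (k + 1))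
    (hY : Y ∈ C n (k + 1)) (h : X ≠ Y) :
    (lexPacket X).filter (· ∈ packet Y) = (antiPacket X).filter (· ∈ packet Y) := by
  have hXc : X.card = k + 1 := (Finset.mem_powersetCard.1 hX).2
  have hYc : Y.card = k + 1 := (Finset.mem_powersetCard.1 hY).2
  have hXn : X.Nonempty := Finset.card_pos.1 (by omega)
  have key : ∀ A ∈ (antiPacket X).filter (· ∈ packet Y), A = X ∩ Y := by
    intro A hA
    simp only [List.mem_filter, decide_eq_true_eq] at hA
    have h1 := (mem_antiPacket hXn).1 hA.1
    have h2 := hA.2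
    simp only [packet, Finset.mem_powersetCard] at h1 h2
    refine Finset.eq_of_subset_of_card_le (Finset.subset_inter h1.1 h2.1) ?_
    have hlt : (X ∩ Y).card < X.card := by
      refine Finset.card_lt_card (Finset.ssubset_iff_subset_ne.2 ⟨Finset.inter_subset_left, ?_⟩)
      intro he
      exact h (Finset.eq_of_subset_of_card_le (Finset.inter_eq_left.1 he) (by omega))
    omega
  have hr := List.eq_replicate_of_mem key
  rw [lexPacket, List.filter_reverse, hr, List.reverse_replicate]

theorem FlipUp.inv_ssubset {n k : ℕ} {J : Finset (Finset (Fin n))} {r r' : SecondBruhat n k J}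
    (h : FlipUp r r') : r.inv ⊂ r'.inv := by
  obtain ⟨ρ, ρ', X, a, b, rfl, rfl, hX, hXr, h1, h2⟩ := h
  change X ∉ HigherBruhat.inv n k J ρ.1 at hXr
  change HigherBruhat.inv n k J ρ.1 ⊂ HigherBruhat.inv n k J ρ'.1
  have hXC : X ∈ C n (k + 1) := (Finset.mem_filter.1 hX).1
  have hXc : X.card = k + 1 := (Finset.mem_powersetCard.1 hXC).2
  have hXn : X.Nonempty := Finset.card_pos.1 (by omega)
  have hself : (antiPacket X).filter (· ∈ packet X) = antiPacket X :=
    List.filter_eq_self.2 fun A hA => by simpa using (mem_antiPacket hXn).1 hA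
  have hnd : (a ++ antiPacket X ++ b).Nodup := h2 ▸ ρ'.2.nodup
  have hmem : X ∈ HigherBruhat.inv n k J ρ'.1 := by
    unfold HigherBruhat.inv
    refine Finset.mem_union_right _ (Finset.mem_filter.2 ⟨hX, ?_⟩)
    rw [List.nodup_append, List.nodup_append] at hnd
    have ha : a.filter (· ∈ packet X) = [] := by
      refine List.filter_eq_nil_iff.2 fun A hA hA' => ?_
      exact hnd.1.2.2 A hA A ((mem_antiPacket hXn).2 (by simpa using hA')) rfl
    have hb : b.filter (· ∈ packet X) = [] := by
      refine List.filter_eq_nil_iff.2 fun A hA hA' => ?_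
      exact hnd.2.2 A (List.mem_append_right _ ((mem_antiPacket hXn).2 (by simpa using hA')))
        A hA rfl
    rw [h2, List.filter_append, List.filter_append, ha, hb, hself]
    simp
  refine Finset.ssubset_iff_subset_ne.2 ⟨?_, fun he => hXr (he ▸ hmem)⟩
  intro Y hY
  by_cases hYX : X = Y
  · exact hYX ▸ hmem
  unfold HigherBruhat.inv at hY ⊢
  rcases Finset.mem_union.1 hY with hY | hY
  · exact Finset.mem_union_left _ hY
  · obtain ⟨hYF, hYe⟩ := Finset.mem_filter.1 hY
    refine Finset.mem_union_right _ (Finset.mem_filter.2 ⟨hYF, ?_⟩)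
    rw [← hYe, h1, h2]
    simp only [List.filter_append]
    rw [filter_packet_short hXC (Finset.mem_filter.1 hYF).1 hYX]

theorem inv_subset_of_flips {n k : ℕ} {J : Finset (Finset (Fin n))} {r r' : SecondBruhat n k J}
    (h : Relation.ReflTransGen FlipUp r r') : r.inv ⊆ r'.inv := by
  induction h with
  | refl => exact subset_rfl
  | tail _ h ih => exact ih.trans h.inv_ssubset.subset

/-- The Manin–Schechtman order: `r ≤ r'` if a sequence of upward packet flips leads from `r`
to `r'`. -/
instance {n k : ℕ} {J : Finset (Finset (Fin n))} : PartialOrder (SecondBruhat n k J) where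
  le := Relation.ReflTransGen FlipUp
  le_refl _ := Relation.ReflTransGen.refl
  le_trans _ _ _ := Relation.ReflTransGen.trans
  le_antisymm r r' h h' := by
    rcases Relation.ReflTransGen.cases_head h with rfl | ⟨s, hs, hsr⟩
    · rfl
    · exact absurd ((inv_subset_of_flips hsr).trans (inv_subset_of_flips h')) hs.inv_ssubset.2

/-- The list `l` is the total order on `J_F` given by the maximal chain `c` of the second Bruhat
order of `J`: `X` comes before `Y` exactly when `X` enters the inversion sets along `c` before `Y`. -/
def Induces {n k : ℕ} {J : Finset (Finset (Fin n))} (c : Flag (SecondBruhat n k J))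
    (l : List (Finset (Fin n))) : Prop :=
  l.Nodup ∧ l.toFinset = fullSet n k J ∧
    ∀ X ∈ fullSet n k J, ∀ Y ∈ fullSet n k J,
      (l.idxOf X < l.idxOf Y ↔ ∃ r ∈ c, X ∈ r.inv ∧ Y ∉ r.inv)

/-- `𝒪_F`: the total orders on `J_F` given by maximal chains of the second Bruhat order of `J`. -/
def chainOrders (n k : ℕ) (J : Finset (Finset (Fin n))) : Set (List (Finset (Fin n))) :=
  {l | ∃ c : Flag (SecondBruhat n k J), Induces c l}

/-- The orders on `J_s ∪ J_F` obtained by prepending `ρs` to the members of `𝒪_F`. -/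
def extOrders (n k : ℕ) (J : Finset (Finset (Fin n))) (ρs : List (Finset (Fin n))) :
    Set (List (Finset (Fin n))) :=
  {ρ | ∃ l ∈ chainOrders n k J, ρ = ρs ++ l}

/-- The admissible `(J_s ∪ J_F)`-orders in which every element of `J_s` precedes every element
of `J_F`. -/
def sufFirstOrders (n k : ℕ) (J : Finset (Finset (Fin n))) : Set (List (Finset (Fin n))) :=
  {ρ | IsAdm n (k + 1) (sufSet n k J ∪ fullSet n k J) ρ ∧
    ∀ s ∈ sufSet n k J, ∀ f ∈ fullSet n k J, ρ.idxOf s < ρ.idxOf f}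

/-- The image under `π` of a set `S` of admissible `J`-orders. -/
def classes (n k : ℕ) (J : Finset (Finset (Fin n))) (S : Set (List (Finset (Fin n)))) :
    Set (SecondBruhat n k J) :=
  {r | ∃ ρ : Adm n k J, ρ.1 ∈ S ∧ proj ρ = r}

/-- The third Bruhat order of `J`, as a subset (hence a subposet) of the second Bruhat order of the
realizable `(k+1)`-set `J_s ∪ J_F`. -/
def thirdBruhat (n k : ℕ) (J : Finset (Finset (Fin n))) :
    Set (SecondBruhat n (k + 1) (sufSet n k J ∪ fullSet n k J)) :=
  classes n (k + 1) (sufSet n k J ∪ fullSet n k J) (sufFirstOrders n k J)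

end HigherBruhat

namespace HigherBruhat

/-! Everything is translated into sets that meet every packet in a prefix or a suffix ("consistent"
sets). By `consistent_of_three` this is a betweenness condition on triples of deletions `a < b < c`:
the middle one cannot be in the set alone, nor be the only one missing.

Two facts turn second Bruhat orders into combinatorics of such sets. The packet relation of a
consistent set is acyclic (`Consistent.exists_rank`), so each consistent `I` with `J_s ⊆ I ⊆ J_s ∪
J_F` is the inversion set of some admissible `J`-order. Conversely every inversion set is
consistent: a violation on a triple would produce a cycle of length three among positions. Since an
admissible order is determined up to interchanges by its restrictions to packets
(`swapSteps_of_filter_eq`), classes of admissible orders correspond exactly to these `I`, and an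
upward flip is the addition of one element (`flipUp_iff`). One element can always be added or
removed until the extreme sets are reached (`Between.exists_insert`, `Between.exists_erase`), so
there are a bottom `J_s` and a top `J_s ∪ J_F`, and along a maximal chain the elements of `J_F`
enter one at a time. A total order on `J_F` therefore comes from a maximal chain exactly when `J_s`
together with each of its initial segments is consistent.

Admissibility has the same form: an order is admissible if and only if all its initial segments are
consistent (`IsAdm.consistent_prefix`, `isAdm_of_consistent_prefix`). For an order listing `J_s`
before `J_F`, this condition splits into admissibility of the part on `J_s` and the chain condition
above for the part on `J_F`. Finally no packet lies entirely in `J_s` (`fullSet_sufSet`), so all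
admissible `J_s`-orders agree on every packet, and the choice of one does not affect the class. -/

/-- Membership of the packet of `Z` in `J` passes to the deletion of larger elements. -/
def IncAt {n : ℕ} (J : Finset (Finset (Fin n))) (Z : Finset (Fin n)) : Prop :=
  ∀ x ∈ Z, ∀ y ∈ Z, x < y → Z.erase x ∈ J → Z.erase y ∈ J

/-- Membership of the packet of `Z` in `J` passes to the deletion of smaller elements. -/
def DecAt {n : ℕ} (J : Finset (Finset (Fin n))) (Z : Finset (Fin n)) : Prop :=
  ∀ x ∈ Z, ∀ y ∈ Z, x < y → Z.erase y ∈ J → Z.erase x ∈ J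

/-- `J` meets every packet in a prefix or a suffix. -/
def Consistent {n : ℕ} (J : Finset (Finset (Fin n))) : Prop := ∀ Z, IncAt J Z ∨ DecAt J Z

/-- An ascent of `p` and a descent of `p` cannot coexist: among their endpoints there is always a
triple whose middle value differs from both outer ones. -/
theorem inc_or_dec_of_three {α : Type*} [LinearOrder α] {Z : Finset α} {p : α → Prop}
    (h : ∀ a ∈ Z, ∀ b ∈ Z, ∀ c ∈ Z, a < b → b < c →
      (p b → p a ∨ p c) ∧ (p a → p c → p b)) :
    (∀ x ∈ Z, ∀ y ∈ Z, x < y → p x → p y) ∨ (∀ x ∈ Z, ∀ y ∈ Z, x < y → p y → p x) := by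
  by_contra! hc
  obtain ⟨⟨x, hx, y, hy, hxy, px, py⟩, u, hu, v, hv, huv, pv, pu⟩ := hc
  have hyv : y ≠ v := by rintro rfl; exact py pv
  have hxu : x ≠ u := by rintro rfl; exact pu px
  rcases lt_or_gt_of_ne hyv with h1 | h1
  · exact py ((h x hx y hy v hv hxy h1).2 px pv)
  · have h2 := (h u hu v hv y hy huv h1).1 pv
    tauto

theorem Consistent.three {n : ℕ} {J : Finset (Finset (Fin n))} (hJ : Consistent J)
    {Z : Finset (Fin n)} {a b c : Fin n} (ha : a ∈ Z) (hb : b ∈ Z) (hc : c ∈ Z) (hab : a < b)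
    (hbc : b < c) : (Z.erase b ∈ J → Z.erase a ∈ J ∨ Z.erase c ∈ J) ∧
      (Z.erase a ∈ J → Z.erase c ∈ J → Z.erase b ∈ J) := by
  rcases hJ Z with h | h
  · exact ⟨fun q => Or.inr (h b hb c hc hbc q), fun q _ => h a ha b hb hab q⟩
  · exact ⟨fun q => Or.inl (h a ha b hb hab q), fun _ q => h b hb c hc hbc q⟩

theorem consistent_of_three {n : ℕ} {J : Finset (Finset (Fin n))}
    (h : ∀ Z : Finset (Fin n), ∀ a ∈ Z, ∀ b ∈ Z, ∀ c ∈ Z, a < b → b < c →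
      (Z.erase b ∈ J → Z.erase a ∈ J ∨ Z.erase c ∈ J) ∧
      (Z.erase a ∈ J → Z.erase c ∈ J → Z.erase b ∈ J)) : Consistent J := fun Z =>
  inc_or_dec_of_three (p := fun x => Z.erase x ∈ J) (h Z)

/-! ### Lists -/

theorem filter_prefix_iff {β : Type*} (p : β → Bool) (l : List β) :
    l.filter p <+: l ↔ l.Pairwise fun a b => p b → p a := by
  induction l with
  | nil => simp
  | cons x t ih =>
    by_cases hx : p x
    · simp [hx, ih]
    · rw [List.filter_cons_of_neg (by simpa using hx), List.pairwise_cons]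
      constructor
      · intro h
        have h0 : t.filter p = [] := by
          rcases hf : t.filter p with _ | ⟨y, s⟩
          · rfl
          · rw [hf, List.cons_prefix_cons] at h
            have : y ∈ t.filter p := by simp [hf]
            exact absurd (h.1 ▸ (List.mem_filter.1 this).2) hx
        rw [List.filter_eq_nil_iff] at h0
        exact ⟨fun b hb q => absurd q (h0 b hb),
          List.pairwise_of_forall_mem_list fun a _ b hb q => absurd q (h0 b hb)⟩
      · rintro ⟨h, -⟩
        rw [List.filter_eq_nil_iff.2 fun b hb q => hx (h b hb q)]
        exact List.nil_prefix

theorem filter_suffix_iff {β : Type*} (p : β → Bool) (l : List β) :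
    l.filter p <:+ l ↔ l.Pairwise fun a b => p a → p b := by
  rw [← List.reverse_prefix, ← List.filter_reverse, filter_prefix_iff, List.pairwise_reverse]

theorem pairwise_sort_iff {α : Type*} [LinearOrder α] (X : Finset α) (S : α → α → Prop) :
    (X.sort (· ≤ ·)).Pairwise S ↔ ∀ x ∈ X, ∀ y ∈ X, x < y → S x y := by
  have hs : (X.sort (· ≤ ·)).Pairwise (· < ·) := Finset.sortedLT_sort X |>.pairwise
  constructor
  · intro h x hx y hy hxy
    rw [← Finset.mem_sort (· ≤ ·)] at hx hy
    obtain ⟨i, hi, rfl⟩ := List.getElem_of_mem hx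
    obtain ⟨j, hj, rfl⟩ := List.getElem_of_mem hy
    rw [List.pairwise_iff_getElem] at h hs
    rcases lt_trichotomy i j with hij | rfl | hij
    · exact h i j hi hj hij
    · exact absurd hxy (lt_irrefl _)
    · exact absurd hxy (hs j i hj hi hij).asymm
  · intro h
    refine hs.imp_of_mem fun {a b} ha hb hab => ?_
    exact h a ((Finset.mem_sort _).1 ha) b ((Finset.mem_sort _).1 hb) hab

theorem pairwise_antiPacket {n : ℕ} (X : Finset (Fin n))
    (S : Finset (Fin n) → Finset (Fin n) → Prop) :
    (antiPacket X).Pairwise S ↔ ∀ x ∈ X, ∀ y ∈ X, x < y → S (X.erase x) (X.erase y) := by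
  rw [antiPacket, List.pairwise_map, pairwise_sort_iff]

theorem pairwise_lexPacket {n : ℕ} (X : Finset (Fin n))
    (S : Finset (Fin n) → Finset (Fin n) → Prop) :
    (lexPacket X).Pairwise S ↔ ∀ x ∈ X, ∀ y ∈ X, x < y → S (X.erase y) (X.erase x) := by
  rw [lexPacket, List.pairwise_reverse, pairwise_antiPacket]

/-! ### Packets and realizability in terms of deletions -/

theorem mem_C {n k : ℕ} {A : Finset (Fin n)} : A ∈ C n k ↔ A.card = k := by
  simp [C, Finset.mem_powersetCard]

theorem mem_antiPacket_iff {n : ℕ} {X A : Finset (Fin n)} :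
    A ∈ antiPacket X ↔ ∃ x ∈ X, X.erase x = A := by
  simp [antiPacket]

theorem mem_lexPacket_iff {n : ℕ} {X A : Finset (Fin n)} :
    A ∈ lexPacket X ↔ ∃ x ∈ X, X.erase x = A := by
  simp [lexPacket, antiPacket]

theorem mem_packet_iff {n : ℕ} {X A : Finset (Fin n)} (hX : X.Nonempty) :
    A ∈ packet X ↔ ∃ x ∈ X, X.erase x = A := by
  rw [← mem_antiPacket hX, mem_antiPacket_iff]

theorem nonempty_of_mem_C {n k : ℕ} {X : Finset (Fin n)} (hX : X ∈ C n (k + 1)) : X.Nonempty :=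
  Finset.card_pos.1 (by rw [mem_C.1 hX]; omega)

theorem mem_C_succ {n k : ℕ} {X : Finset (Fin n)} {x : Fin n} (hx : x ∈ X)
    (h : X.erase x ∈ C n k) : X ∈ C n (k + 1) := by
  rw [mem_C] at h ⊢
  rw [← h, Finset.card_erase_add_one hx]

theorem nodup_antiPacket {n : ℕ} (X : Finset (Fin n)) : (antiPacket X).Nodup := by
  rw [List.Nodup, pairwise_antiPacket]
  intro x hx y hy hxy h
  exact hxy.ne (Finset.erase_injOn X hx hy h)

theorem nodup_lexPacket {n : ℕ} (X : Finset (Fin n)) : (lexPacket X).Nodup :=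
  List.nodup_reverse.2 (nodup_antiPacket X)

theorem inter_prefix_iff {n : ℕ} (J : Finset (Finset (Fin n))) (X : Finset (Fin n)) :
    inter J X <+: lexPacket X ↔ IncAt J X := by
  rw [inter, filter_prefix_iff, pairwise_lexPacket]
  simp [IncAt]

theorem inter_suffix_iff {n : ℕ} (J : Finset (Finset (Fin n))) (X : Finset (Fin n)) :
    inter J X <:+ lexPacket X ↔ DecAt J X := by
  rw [inter, filter_suffix_iff, pairwise_lexPacket]
  simp [DecAt]

theorem realizable_iff {n k : ℕ} {J : Finset (Finset (Fin n))} :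
    Realizable n k J ↔ J ⊆ C n k ∧ Consistent J := by
  unfold Realizable
  refine and_congr_right fun hJ => ?_
  simp only [inter_prefix_iff, inter_suffix_iff]
  refine ⟨fun h Z => ?_, fun h X _ => h X⟩
  by_cases hZ : Z ∈ C n (k + 1)
  · exact h Z hZ
  -- A set of the wrong size has no deletion in `J`, so quantifying over all `Z` costs nothing.
  · exact Or.inl fun x hx y _ _ hxJ => absurd (mem_C_succ hx (hJ hxJ)) hZ

theorem inter_ne_nil_iff {n : ℕ} (J : Finset (Finset (Fin n))) (X : Finset (Fin n)) :
    inter J X ≠ [] ↔ ∃ x ∈ X, X.erase x ∈ J := by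
  rw [inter, Ne, List.filter_eq_nil_iff]
  simp [mem_lexPacket_iff]

theorem inter_ne_lexPacket_iff {n : ℕ} (J : Finset (Finset (Fin n))) (X : Finset (Fin n)) :
    inter J X ≠ lexPacket X ↔ ∃ x ∈ X, X.erase x ∉ J := by
  rw [inter, Ne, List.filter_eq_self]
  simp [mem_lexPacket_iff]

theorem mem_sufSet {n k : ℕ} {J : Finset (Finset (Fin n))} (hJ : Realizable n k J)
    {X : Finset (Fin n)} : X ∈ sufSet n k J ↔ ¬ IncAt J X := by
  obtain ⟨hJC, hJ⟩ := realizable_iff.1 hJ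
  rw [sufSet, Finset.mem_filter, inter_suffix_iff, inter_ne_nil_iff, inter_ne_lexPacket_iff]
  constructor
  · rintro ⟨-, hd, ⟨x, hx, hxJ⟩, y, hy, hyJ⟩ hi
    rcases lt_trichotomy x y with h | rfl | h
    · exact hyJ (hi x hx y hy h hxJ)
    · exact hyJ hxJ
    · exact hyJ (hd y hy x hx h hxJ)
  · intro hi
    have hd := (hJ X).resolve_left hi
    unfold IncAt at hi
    push Not at hi
    obtain ⟨x, hx, y, hy, -, h1, h2⟩ := hi
    exact ⟨mem_C_succ hx (hJC h1), hd, ⟨x, hx, h1⟩, y, hy, h2⟩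

theorem mem_preSet {n k : ℕ} {J : Finset (Finset (Fin n))} (hJ : Realizable n k J)
    {X : Finset (Fin n)} : X ∈ preSet n k J ↔ ¬ DecAt J X := by
  obtain ⟨hJC, hJ⟩ := realizable_iff.1 hJ
  rw [preSet, Finset.mem_filter, inter_prefix_iff, inter_ne_nil_iff, inter_ne_lexPacket_iff]
  constructor
  · rintro ⟨-, hi, ⟨x, hx, hxJ⟩, y, hy, hyJ⟩ hd
    rcases lt_trichotomy x y with h | rfl | h
    · exact hyJ (hi x hx y hy h hxJ)
    · exact hyJ hxJ
    · exact hyJ (hd y hy x hx h hxJ)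
  · intro hd
    have hi := (hJ X).resolve_right hd
    unfold DecAt at hd
    push Not at hd
    obtain ⟨x, hx, y, hy, -, h1, h2⟩ := hd
    exact ⟨mem_C_succ hy (hJC h1), hi, ⟨y, hy, h1⟩, x, hx, h2⟩

theorem mem_fullSet {n k : ℕ} {J : Finset (Finset (Fin n))} {X : Finset (Fin n)} :
    X ∈ fullSet n k J ↔ X ∈ C n (k + 1) ∧ ∀ x ∈ X, X.erase x ∈ J := by
  rw [fullSet, Finset.mem_filter]
  refine and_congr_right fun hX => ?_
  constructor
  · exact fun h x hx => h ((mem_packet_iff (nonempty_of_mem_C hX)).2 ⟨x, hx, rfl⟩)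
  · intro h A hA
    obtain ⟨x, hx, rfl⟩ := (mem_packet_iff (nonempty_of_mem_C hX)).1 hA
    exact h x hx

theorem sufSet_subset_C {n k : ℕ} (J : Finset (Finset (Fin n))) : sufSet n k J ⊆ C n (k + 1) :=
  Finset.filter_subset _ _

theorem fullSet_subset_C {n k : ℕ} (J : Finset (Finset (Fin n))) : fullSet n k J ⊆ C n (k + 1) :=
  Finset.filter_subset _ _

theorem disjoint_sufSet_fullSet {n k : ℕ} {J : Finset (Finset (Fin n))} (hJ : Realizable n k J)
    {X : Finset (Fin n)} (hs : X ∈ sufSet n k J) (hf : X ∈ fullSet n k J) : False :=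
  (mem_sufSet hJ).1 hs fun _ _ y hy _ _ => (mem_fullSet.1 hf).2 y hy

/-- Membership in `J_s ∪ J_F` means that the packet meets `J` and does so in a suffix. -/
theorem mem_sufSet_union_fullSet {n k : ℕ} {J : Finset (Finset (Fin n))} (hJ : Realizable n k J)
    {X : Finset (Fin n)} : X ∈ sufSet n k J ∪ fullSet n k J ↔
      DecAt J X ∧ ∃ x ∈ X, X.erase x ∈ J := by
  obtain ⟨hJC, hJc⟩ := realizable_iff.1 hJ
  rw [Finset.mem_union, mem_sufSet hJ, mem_fullSet]
  constructor
  · rintro (h | ⟨hX, h⟩)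
    · refine ⟨(hJc X).resolve_left h, ?_⟩
      unfold IncAt at h
      push Not at h
      obtain ⟨x, hx, -, -, -, h1, -⟩ := h
      exact ⟨x, hx, h1⟩
    · obtain ⟨x, hx⟩ := nonempty_of_mem_C hX
      exact ⟨fun x hx _ _ _ _ => h x hx, x, hx, h x hx⟩
  · rintro ⟨hd, x, hx, hxJ⟩
    rw [or_iff_not_imp_left, not_not]
    refine fun hi => ⟨mem_C_succ hx (hJC hxJ), fun y hy => ?_⟩
    rcases lt_trichotomy x y with h | rfl | h
    · exact hi x hx y hy h hxJ
    · exact hxJ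
    · exact hd y hy x hx h hxJ

/-! ### Acyclicity of the packet relation of a consistent set -/

/-- Induction on the largest ground element `m`: both the restriction of `I` to subsets of `S` and
its link at `m` satisfy the triple condition, and their rank functions are stacked. All
cardinalities are handled at once. -/
theorem exists_rank_aux {n : ℕ} (S : Finset (Fin n)) : ∀ I : Set (Finset (Fin n)),
    (∀ Z ⊆ S, ∀ a ∈ Z, ∀ b ∈ Z, ∀ c ∈ Z, a < b → b < c →
      (Z.erase b ∈ I → Z.erase a ∈ I ∨ Z.erase c ∈ I) ∧
      (Z.erase a ∈ I → Z.erase c ∈ I → Z.erase b ∈ I)) →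
    ∃ f : Finset (Fin n) → ℕ, ∀ X ⊆ S, ∀ x ∈ X, ∀ y ∈ X, x < y →
      (X ∈ I → f (X.erase x) < f (X.erase y)) ∧ (X ∉ I → f (X.erase y) < f (X.erase x)) := by
  classical
  induction S using Finset.induction_on_max with
  | empty =>
    intro I _
    refine ⟨fun _ => 0, fun X hX x hx => ?_⟩
    exact absurd (hX hx) (Finset.notMem_empty x)
  | insert m S hm ih =>
    intro I hI
    have hmS : m ∉ S := fun h => lt_irrefl _ (hm m h)
    obtain ⟨f₁, hf₁⟩ := ih I fun Z hZ => hI Z (hZ.trans (Finset.subset_insert m S))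
    obtain ⟨f₂, hf₂⟩ := ih {X | insert m X ∈ I} fun Z hZ a ha b hb c hc hab hbc => by
      have hne : ∀ z ∈ Z, insert m (Z.erase z) = (insert m Z).erase z := fun z hz =>
        (Finset.erase_insert_of_ne (by rintro rfl; exact hmS (hZ hz))).symm
      simp only [Set.mem_ofPred_eq, hne a ha, hne b hb, hne c hc]
      exact hI _ (Finset.insert_subset_insert m hZ) a (by simp [ha]) b (by simp [hb]) c
        (by simp [hc]) hab hbc
    obtain ⟨B₁, hB₁⟩ : ∃ B, ∀ A, f₁ A ≤ B := by
      obtain ⟨B, hB⟩ := (Set.finite_range f₁).bddAbove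
      exact ⟨B, fun A => hB ⟨A, rfl⟩⟩
    obtain ⟨B₂, hB₂⟩ : ∃ B, ∀ A, f₂ A ≤ B := by
      obtain ⟨B, hB⟩ := (Set.finite_range f₂).bddAbove
      exact ⟨B, fun A => hB ⟨A, rfl⟩⟩
    -- Three layers: at the bottom the `A` avoiding `m` with `A ∪ {m} ∉ I`, then the sets containing
    -- `m`, and on top the `A` avoiding `m` with `A ∪ {m} ∈ I`. This is forced, because `A` is the
    -- last deletion in the packet of `A ∪ {m}`.
    refine ⟨fun A => if m ∈ A then B₁ + 1 + f₂ (A.erase m)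
      else if insert m A ∈ I then B₁ + B₂ + 2 + f₁ A else f₁ A, fun X hX x hx y hy hxy => ?_⟩
    have b1 := hB₁ (X.erase x)
    have b2 := hB₁ (X.erase y)
    have b3 := hB₂ ((X.erase x).erase m)
    by_cases hmX : m ∈ X
    · have hXm : X.erase m ⊆ S := by
        intro z hz
        exact (Finset.mem_insert.1 (hX (Finset.mem_of_mem_erase hz))).resolve_left
          (Finset.ne_of_mem_erase hz)
      have hxm : x ≠ m := by
        rintro rfl
        rcases Finset.mem_insert.1 (hX hy) with h | h
        · exact hxy.ne h.symm
        · exact hxy.asymm (hm y h)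
      by_cases hym : y = m
      · subst hym
        simp only [Finset.mem_erase, hmX, hxm.symm, ne_eq, not_false_eq_true, not_true_eq_false,
          and_true, if_true, if_false, Finset.insert_erase hmX]
        constructor
        · intro h
          rw [if_pos h]
          omega
        · intro h
          rw [if_neg h]
          omega
      · have := hf₂ (X.erase m) hXm x (by simp [hx, hxm]) y (by simp [hy, hym]) hxy
        rw [Set.mem_ofPred_eq, Finset.insert_erase hmX, Finset.erase_right_comm (a := m) (b := x),
          Finset.erase_right_comm (a := m) (b := y)] at this
        simp only [Finset.mem_erase, hmX, hxm.symm, Ne.symm hym, ne_eq, not_false_eq_true,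
          and_true, if_true]
        exact ⟨fun h => by have := this.1 h; omega, fun h => by have := this.2 h; omega⟩
    · have hXS : X ⊆ S := fun z hz => (Finset.mem_insert.1 (hX hz)).resolve_left
        fun h => hmX (h ▸ hz)
      have hmx : m ∉ X.erase x := fun h => hmX (Finset.mem_of_mem_erase h)
      have hmy : m ∉ X.erase y := fun h => hmX (Finset.mem_of_mem_erase h)
      have hne : ∀ z ∈ X, insert m (X.erase z) = (insert m X).erase z := fun z hz =>
        (Finset.erase_insert_of_ne (by rintro rfl; exact hmX hz)).symm
      -- The triple condition for `x < y < m` in `X ∪ {m}` is what prevents two deletions of `X`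
      -- from landing in layers that contradict their order.
      have h3 := hI _ (Finset.insert_subset_insert m hXS) x (by simp [hx]) y (by simp [hy]) m
        (by simp) hxy (hm y (hXS hy))
      rw [Finset.erase_insert hmX] at h3
      have h1 := hf₁ X hXS x hx y hy hxy
      simp only [if_neg hmx, if_neg hmy, hne x hx, hne y hy]
      by_cases hX : X ∈ I <;> simp only [hX, true_imp_iff, not_true_eq_false, false_imp_iff,
        not_false_eq_true, and_true, true_and] at h1 h3 ⊢ <;> split_ifs <;> first | omega | tauto

/-- The packet relation of a consistent set is acyclic: it is compatible with a rank function. -/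
theorem Consistent.exists_rank {n : ℕ} {I : Finset (Finset (Fin n))} (hI : Consistent I) :
    ∃ f : Finset (Fin n) → ℕ, ∀ X : Finset (Fin n), ∀ x ∈ X, ∀ y ∈ X, x < y →
      (X ∈ I → f (X.erase x) < f (X.erase y)) ∧ (X ∉ I → f (X.erase y) < f (X.erase x)) := by
  obtain ⟨f, hf⟩ := exists_rank_aux Finset.univ (I : Set (Finset (Fin n)))
    fun Z _ a ha b hb c hc hab hbc => hI.three ha hb hc hab hbc
  exact ⟨f, fun X => hf X (Finset.subset_univ X)⟩

/-! ### Rows of a packet of packets -/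

theorem exists_min_mem {α : Type*} [LinearOrder α] {Z : Finset α} (hZ : Z.Nonempty) :
    ∃ m ∈ Z, ∀ z ∈ Z, z ≠ m → m < z :=
  ⟨Z.min' hZ, Z.min'_mem hZ, fun _ hz h => lt_of_le_of_ne (Z.min'_le _ hz) h.symm⟩

theorem exists_max_mem {α : Type*} [LinearOrder α] {Z : Finset α} (hZ : Z.Nonempty) :
    ∃ m ∈ Z, ∀ z ∈ Z, z ≠ m → z < m :=
  ⟨Z.max' hZ, Z.max'_mem hZ, fun _ hz h => lt_of_le_of_ne (Z.le_max' _ hz) h⟩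

/-- If the packet of `X` meets `J` in a suffix, then it contains `X` without its minimum as soon as
it is nonempty. -/
theorem DecAt.erase_min {n : ℕ} {J : Finset (Finset (Fin n))} {X : Finset (Fin n)} {m x : Fin n}
    (h : DecAt J X) (hm : m ∈ X) (hmin : ∀ z ∈ X, z ≠ m → m < z) (hx : x ∈ X)
    (hxJ : X.erase x ∈ J) : X.erase m ∈ J := by
  by_cases hxm : x = m
  · exact hxm ▸ hxJ
  · exact h m hm x hx (hmin x hx hxm) hxJ

theorem DecAt.erase_max {n : ℕ} {J : Finset (Finset (Fin n))} {X : Finset (Fin n)} {m x : Fin n}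
    (h : DecAt J X) (hm : m ∈ X) (hmax : ∀ z ∈ X, z ≠ m → z < m) (hx : x ∈ X)
    (hxJ : X.erase x ∉ J) : X.erase m ∉ J := by
  by_cases hxm : x = m
  · exact hxm ▸ hxJ
  · exact fun hmJ => hxJ (h x hx m hm (hmax x hx hxm) hmJ)

/-- The entries of the first and last columns in a row that is a proper nonempty suffix. -/
theorem not_incAt_ends {n : ℕ} {J : Finset (Finset (Fin n))} {X : Finset (Fin n)}
    (hJ : Consistent J) (h : ¬ IncAt J X) :
    DecAt J X ∧ (∀ m ∈ X, (∀ z ∈ X, z ≠ m → m < z) → X.erase m ∈ J) ∧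
      (∀ m ∈ X, (∀ z ∈ X, z ≠ m → z < m) → X.erase m ∉ J) := by
  have hd := (hJ X).resolve_left h
  unfold IncAt at h
  push Not at h
  obtain ⟨x, hx, y, hy, -, h1, h2⟩ := h
  exact ⟨hd, fun m hm hmin => hd.erase_min hm hmin hx h1,
    fun m hm hmax => hd.erase_max hm hmax hy h2⟩

/-- The relations between the entries of the rows `a < b < c` in a packet of packets: row `i` is
increasing if `S i` holds, decreasing if `T i` holds, and a proper nonempty suffix unless `S i`. -/
structure RowSystem {n : ℕ} (e : Fin n → Fin n → Prop) (Z : Finset (Fin n)) (S T : Fin n → Prop) :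
    Prop where
  symm : ∀ i j, e i j → e j i
  inc : ∀ i ∈ Z, S i → ∀ x ∈ Z, ∀ y ∈ Z, x ≠ i → y ≠ i → x < y → e i x → e i y
  dec : ∀ i ∈ Z, T i → ∀ x ∈ Z, ∀ y ∈ Z, x ≠ i → y ≠ i → x < y → e i y → e i x
  inc_or_dec : ∀ i ∈ Z, S i ∨ T i
  first : ∀ i ∈ Z, ¬ S i → ∀ m ∈ Z, m ≠ i → (∀ z ∈ Z, z ≠ m → m < z) → e i m
  last : ∀ i ∈ Z, ¬ S i → ∀ m ∈ Z, m ≠ i → (∀ z ∈ Z, z ≠ m → z < m) → ¬ e i m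

theorem Consistent.rowSystem {n : ℕ} {J : Finset (Finset (Fin n))} (hJ : Consistent J)
    (Z : Finset (Fin n)) : RowSystem (fun i j => (Z.erase i).erase j ∈ J) Z
      (fun i => IncAt J (Z.erase i)) (fun i => DecAt J (Z.erase i)) where
  symm i j h := by rwa [Finset.erase_right_comm]
  inc i _ h x hx y hy hxi hyi := h x (by simp [hx, hxi]) y (by simp [hy, hyi])
  dec i _ h x hx y hy hxi hyi := h x (by simp [hx, hxi]) y (by simp [hy, hyi])
  inc_or_dec i _ := hJ _
  first i _ h m hm hmi hmin := (not_incAt_ends hJ h).2.1 m (by simp [hm, hmi])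
    fun z hz => hmin z (Finset.mem_of_mem_erase hz)
  last i _ h m hm hmi hmax := (not_incAt_ends hJ h).2.2 m (by simp [hm, hmi])
    fun z hz => hmax z (Finset.mem_of_mem_erase hz)

theorem RowSystem.three {n : ℕ} {e : Fin n → Fin n → Prop} {Z : Finset (Fin n)}
    {S T : Fin n → Prop} (h : RowSystem e Z S T) {i a b c : Fin n} (hi : i ∈ Z) (ha : a ∈ Z)
    (hb : b ∈ Z) (hc : c ∈ Z) (hia : a ≠ i) (hib : b ≠ i) (hic : c ≠ i) (hab : a < b)
    (hbc : b < c) : (e i b → e i a ∨ e i c) ∧ (e i a → e i c → e i b) := by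
  rcases h.inc_or_dec i hi with hs | hs
  · exact ⟨fun q => Or.inr (h.inc i hi hs b hb c hc hib hic hbc q),
      fun q _ => h.inc i hi hs a ha b hb hia hib hab q⟩
  · exact ⟨fun q => Or.inl (h.dec i hi hs a ha b hb hia hib hab q),
      fun _ q => h.dec i hi hs b hb c hc hib hic hbc q⟩

/-- A proper suffix row contains its first column `m` and omits its last column `M`. By symmetry
these entries sit in the rows `m` and `M`, where betweenness holds; monotonicity of the other rows
carries it back. -/
theorem RowSystem.suf_three {n : ℕ} {e : Fin n → Fin n → Prop} {Z : Finset (Fin n)}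
    {S T : Fin n → Prop} (h : RowSystem e Z S T) {a b c : Fin n} (ha : a ∈ Z)
    (hb : b ∈ Z) (hc : c ∈ Z) (hab : a < b) (hbc : b < c) :
    (¬ S b → ¬ S a ∨ ¬ S c) ∧ (¬ S a → ¬ S c → ¬ S b) := by
  obtain ⟨m, hm, hmin⟩ := exists_min_mem ⟨a, ha⟩
  obtain ⟨M, hM, hmax⟩ := exists_max_mem ⟨a, ha⟩
  have hac := hab.trans hbc
  have hcm : c ≠ m := by rintro rfl; exact hac.asymm (hmin a ha hac.ne)
  have hbm : b ≠ m := by rintro rfl; exact hab.asymm (hmin a ha hab.ne)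
  have haM : a ≠ M := by rintro rfl; exact hac.asymm (hmax c hc hac.ne')
  have hbM : b ≠ M := by rintro rfl; exact hbc.asymm (hmax c hc hbc.ne')
  have fi := fun i hi hs => h.first i hi hs m hm
  have la := fun i hi hs => h.last i hi hs M hM
  have rm := h.three (i := m) hm ha hb hc
  have rM := h.three (i := M) hM ha hb hc
  obtain ⟨symm, inc, dec, iod, -, -⟩ := h
  have hmb := hmin b hb hbm
  have hbM' := hmax b hb hbM
  have haM' := hmax a ha haM
  have hmc := hmin c hc hcm
  have da := iod a ha
  have db := iod b hb
  have dc := iod c hc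
  constructor
  · grind
  · grind

/-- For `i ≠ m`, membership in `L` is read off the single column `m`, which by symmetry is row `m`.
Betweenness in that row is the claim, except when `a = m`, where the direction of row `m` takes the
place of the missing entry. -/
theorem RowSystem.suf_full_three {n : ℕ} {e : Fin n → Fin n → Prop} {Z : Finset (Fin n)}
    {S T : Fin n → Prop} (h : RowSystem e Z S T) {a b c : Fin n} (ha : a ∈ Z)
    (hb : b ∈ Z) (hc : c ∈ Z) (hab : a < b) (hbc : b < c) {L : Fin n → Prop}
    (hLdec : ∀ i ∈ Z, L i → T i) (hLinc : ∀ i ∈ Z, ¬ L i → S i)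
    (hL : ∀ i ∈ Z, ∀ m ∈ Z, m ≠ i → (∀ z ∈ Z, z ≠ m → m < z) → (L i ↔ e i m)) :
    (L b → L a ∨ L c) ∧ (L a → L c → L b) := by
  obtain ⟨m, hm, hmin⟩ := exists_min_mem ⟨a, ha⟩
  have hac := hab.trans hbc
  have hcm : c ≠ m := by rintro rfl; exact hac.asymm (hmin a ha hac.ne)
  have hbm : b ≠ m := by rintro rfl; exact hab.asymm (hmin a ha hab.ne)
  have rm := h.three (i := m) hm ha hb hc
  have hL' := fun i hi h => hL i hi m hm h hmin
  obtain ⟨symm, inc, dec, iod, -, -⟩ := h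
  constructor
  · grind
  · grind

/-- If the three entries on the rows `a`, `b`, `c` are all present, a violation gives a strict cycle
among `g a b`, `g a c`, `g b c`. Column `m` and the monotonicity of the rows exclude a violation
with an entry missing. -/
theorem RowSystem.inv_three {n : ℕ} {e : Fin n → Fin n → Prop} {Z : Finset (Fin n)}
    {S T : Fin n → Prop} (h : RowSystem e Z S T) {a b c : Fin n} (ha : a ∈ Z)
    (hb : b ∈ Z) (hc : c ∈ Z) (hab : a < b) (hbc : b < c) {I : Fin n → Prop} {g : Fin n → Fin n → ℕ}
    (hg : ∀ i j, g i j = g j i)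
    (hIdec : ∀ i ∈ Z, I i → T i) (hIinc : ∀ i ∈ Z, ¬ I i → S i)
    (hI : ∀ i ∈ Z, ∀ m ∈ Z, m ≠ i → (∀ z ∈ Z, z ≠ m → m < z) → I i → e i m)
    (hasc : ∀ i ∈ Z, ∀ x ∈ Z, ∀ y ∈ Z, x ≠ i → y ≠ i → x < y → e i x → e i y → I i →
      g i x < g i y)
    (hdesc : ∀ i ∈ Z, ∀ x ∈ Z, ∀ y ∈ Z, x ≠ i → y ≠ i → x < y → e i x → e i y → ¬ I i →
      g i y < g i x) :
    (I b → I a ∨ I c) ∧ (I a → I c → I b) := by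
  obtain ⟨m, hm, hmin⟩ := exists_min_mem ⟨a, ha⟩
  have hac := hab.trans hbc
  have hcm : c ≠ m := by rintro rfl; exact hac.asymm (hmin a ha hac.ne)
  have hbm : b ≠ m := by rintro rfl; exact hab.asymm (hmin a ha hab.ne)
  have rm := h.three (i := m) hm ha hb hc
  have hI' := fun i hi h => hI i hi m hm h hmin
  have a1 := hasc a ha b hb c hc
  have a2 := hasc b hb a ha c hc
  have a3 := hasc c hc a ha b hb
  have d1 := hdesc a ha b hb c hc
  have d2 := hdesc b hb a ha c hc
  have d3 := hdesc c hc a ha b hb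
  have s1 := hg a b
  have s2 := hg a c
  have s3 := hg b c
  obtain ⟨symm, inc, dec, iod, -, -⟩ := h
  clear hasc hdesc hg hI
  constructor
  · grind
  · grind

/-! ### Realizability of `J_s` and `J_s ∪ J_F` -/

theorem realizable_sufSet {n k : ℕ} {J : Finset (Finset (Fin n))} (hJ : Realizable n k J) :
    Realizable n (k + 1) (sufSet n k J) := by
  refine realizable_iff.2 ⟨sufSet_subset_C J, consistent_of_three ?_⟩
  intro Z a ha b hb c hc hab hbc
  simp only [mem_sufSet hJ]
  exact ((realizable_iff.1 hJ).2.rowSystem Z).suf_three ha hb hc hab hbc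

theorem incAt_of_notMem_sufSet_union_fullSet {n k : ℕ} {J : Finset (Finset (Fin n))}
    (hJ : Realizable n k J) {X : Finset (Fin n)} (h : X ∉ sufSet n k J ∪ fullSet n k J) :
    IncAt J X := by
  rw [Finset.mem_union, not_or, mem_sufSet hJ, not_not] at h
  exact h.1

theorem realizable_sufSet_union_fullSet {n k : ℕ} {J : Finset (Finset (Fin n))}
    (hJ : Realizable n k J) : Realizable n (k + 1) (sufSet n k J ∪ fullSet n k J) := by
  refine realizable_iff.2 ⟨Finset.union_subset (sufSet_subset_C J) (fullSet_subset_C J),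
    consistent_of_three ?_⟩
  intro Z a ha b hb c hc hab hbc
  refine ((realizable_iff.1 hJ).2.rowSystem Z).suf_full_three ha hb hc hab hbc
    (L := fun i => Z.erase i ∈ sufSet n k J ∪ fullSet n k J)
    (fun i _ h => ((mem_sufSet_union_fullSet hJ).1 h).1)
    (fun i _ h => incAt_of_notMem_sufSet_union_fullSet hJ h) ?_
  intro i _ m hm hmi hmin
  have hm' : m ∈ Z.erase i := by simp [hm, hmi]
  have hmin' : ∀ z ∈ Z.erase i, z ≠ m → m < z := fun z hz => hmin z (Finset.mem_of_mem_erase hz)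
  constructor
  · intro h
    obtain ⟨hd, x, hx, hxJ⟩ := (mem_sufSet_union_fullSet hJ).1 h
    exact hd.erase_min hm' hmin' hx hxJ
  · intro h
    by_contra hL
    have hi := incAt_of_notMem_sufSet_union_fullSet hJ hL
    have hall : ∀ x ∈ Z.erase i, (Z.erase i).erase x ∈ J := by
      intro x hx
      by_cases hxm : x = m
      · exact hxm ▸ h
      · exact hi m hm' x hx (hmin' x hx hxm) h
    exact hL (Finset.mem_union_right _ (mem_fullSet.2
      ⟨mem_C_succ hm' ((realizable_iff.1 hJ).1 h), hall⟩))

/-! ### Orders compatible with an inversion set -/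

/-- `A` has to come before `B` in every order with inversion set `I`. -/
def Edge {n : ℕ} (I : Finset (Finset (Fin n))) (A B : Finset (Fin n)) : Prop :=
  ∃ X : Finset (Fin n), ∃ x ∈ X, ∃ y ∈ X, x < y ∧
    ((X ∈ I ∧ A = X.erase x ∧ B = X.erase y) ∨ (X ∉ I ∧ A = X.erase y ∧ B = X.erase x))

/-- `I` lies between `J_s` and `J_s ∪ J_F`. -/
structure Between (n k : ℕ) (J I : Finset (Finset (Fin n))) : Prop where
  le : sufSet n k J ⊆ I
  ge : I ⊆ sufSet n k J ∪ fullSet n k J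

theorem Between.subset_C {n k : ℕ} {J I : Finset (Finset (Fin n))} (h : Between n k J I) :
    I ⊆ C n (k + 1) :=
  h.ge.trans (Finset.union_subset (sufSet_subset_C J) (fullSet_subset_C J))

theorem Between.decAt {n k : ℕ} {J I : Finset (Finset (Fin n))} (h : Between n k J I)
    (hJ : Realizable n k J) {X : Finset (Fin n)} (hX : X ∈ I) : DecAt J X :=
  ((mem_sufSet_union_fullSet hJ).1 (h.ge hX)).1

theorem Between.incAt {n k : ℕ} {J I : Finset (Finset (Fin n))} (h : Between n k J I)
    (hJ : Realizable n k J) {X : Finset (Fin n)} (hX : X ∉ I) : IncAt J X := by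
  by_contra hi
  exact hX (h.le ((mem_sufSet hJ).2 hi))

theorem Between.consistent_of_lt {n k : ℕ} {J I : Finset (Finset (Fin n))} (h : Between n k J I)
    (hJ : Realizable n k J) {f : Finset (Fin n) → ℕ}
    (hf : ∀ A ∈ J, ∀ B ∈ J, Edge I A B → f A < f B) : Consistent I := by
  refine consistent_of_three fun Z a ha b hb c hc hab hbc => ?_
  refine ((realizable_iff.1 hJ).2.rowSystem Z).inv_three ha hb hc hab hbc
    (I := fun i => Z.erase i ∈ I) (g := fun i j => f ((Z.erase i).erase j))
    (fun i j => by rw [Finset.erase_right_comm]) (fun i _ hi => h.decAt hJ hi)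
    (fun i _ hi => h.incAt hJ hi) ?_ ?_ ?_
  · intro i _ m hm hmi hmin hi
    obtain ⟨hd, x, hx, hxJ⟩ := (mem_sufSet_union_fullSet hJ).1 (h.ge hi)
    exact hd.erase_min (by simp [hm, hmi]) (fun z hz => hmin z (Finset.mem_of_mem_erase hz)) hx hxJ
  · intro i _ x hx y hy hxi hyi hxy hxJ hyJ hi
    exact hf _ hxJ _ hyJ ⟨_, x, by simp [hx, hxi], y, by simp [hy, hyi], hxy, Or.inl ⟨hi, rfl, rfl⟩⟩
  · intro i _ x hx y hy hxi hyi hxy hxJ hyJ hi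
    exact hf _ hyJ _ hxJ ⟨_, x, by simp [hx, hxi], y, by simp [hy, hyi], hxy, Or.inr ⟨hi, rfl, rfl⟩⟩

theorem Consistent.exists_rank_edge {n : ℕ} {I : Finset (Finset (Fin n))} (hI : Consistent I) :
    ∃ f : Finset (Fin n) → ℕ, ∀ A B, Edge I A B → f A < f B := by
  obtain ⟨f, hf⟩ := hI.exists_rank
  refine ⟨f, ?_⟩
  rintro A B ⟨X, x, hx, y, hy, hxy, ⟨hX, rfl, rfl⟩ | ⟨hX, rfl, rfl⟩⟩
  · exact (hf X x hx y hy hxy).1 hX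
  · exact (hf X x hx y hy hxy).2 hX

/-! ### Adding and removing single elements -/

/-- On a row that `I` meets in a proper suffix, both bounds of `I` point the same way as `I`: a
deletion missing from `I` on the right controls `J_s`, and one present on the left controls `J_s ∪
J_F`, through betweenness. -/
theorem Between.decAt_of_mem_sufSet {n k : ℕ} {J I : Finset (Finset (Fin n))}
    (h : Between n k J I) (hJ : Realizable n k J) (hI : Consistent I) {Z : Finset (Fin n)}
    (hZ : ¬ IncAt I Z) :
    DecAt (sufSet n k J) Z ∧ DecAt (sufSet n k J ∪ fullSet n k J) Z := by
  have hd := (hI Z).resolve_left hZ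
  have hK := (realizable_iff.1 (realizable_sufSet hJ)).2
  have hL := (realizable_iff.1 (realizable_sufSet_union_fullSet hJ)).2
  unfold IncAt at hZ
  push Not at hZ
  obtain ⟨x, hx, y, hy, hxy, hxI, hyI⟩ := hZ
  constructor
  · intro u hu v hv huv hvK
    by_contra huK
    have hvy : v < y := by
      rcases lt_trichotomy v y with h1 | rfl | h1
      · exact h1
      · exact absurd (h.le hvK) hyI
      · exact absurd (hd y hy v hv h1 (h.le hvK)) hyI
    rcases (hK.three hu hv hy huv hvy).1 hvK with h1 | h1
    · exact huK h1
    · exact hyI (h.le h1)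
  · intro u hu v hv huv hvL
    by_contra huL
    have huI : Z.erase u ∉ I := fun h1 => huL (h.ge h1)
    have hxu : x < u := by
      rcases lt_trichotomy x u with h1 | rfl | h1
      · exact h1
      · exact absurd hxI huI
      · exact absurd (hd u hu x hx h1 hxI) huI
    exact huL ((hL.three hx hu hv hxu huv).2 (h.ge hxI) hvL)

/-- Here betweenness alone does not suffice, since `I` may be empty or full on the row. A bound with
the opposite direction would put an extreme deletion of `Z` in `J_F`; one of its entries, shared
with another row, then contradicts the status of that row. -/
theorem Between.incAt_of_notMem_sufSet {n k : ℕ} {J I : Finset (Finset (Fin n))}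
    (h : Between n k J I) (hJ : Realizable n k J) {Z : Finset (Fin n)}
    (hZ : IncAt I Z) :
    IncAt (sufSet n k J) Z ∧ IncAt (sufSet n k J ∪ fullSet n k J) Z := by
  have hJc := (realizable_iff.1 hJ).2
  have hK := (realizable_iff.1 (realizable_sufSet hJ)).2
  have hL := (realizable_iff.1 (realizable_sufSet_union_fullSet hJ)).2
  have hfull : ∀ i ∈ Z, ∀ j ∈ Z, i ≠ j → Z.erase i ∈ sufSet n k J ∪ fullSet n k J →
      Z.erase i ∉ sufSet n k J → (Z.erase i).erase j ∈ J := fun i _ j hj hij h1 h2 =>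
    (mem_fullSet.1 ((Finset.mem_union.1 h1).resolve_left h2)).2 j (by simp [hj, hij.symm])
  constructor
  · by_contra hi
    obtain ⟨M, hM, hmax⟩ := exists_max_mem (Z := Z) (by
      by_contra he
      rw [Finset.not_nonempty_iff_eq_empty] at he
      subst he
      exact hi fun x hx => absurd hx (Finset.notMem_empty x))
    obtain ⟨-, -, h3⟩ := not_incAt_ends hK hi
    unfold IncAt at hi
    push Not at hi
    obtain ⟨u, hu, v, hv, huv, huK, hvK⟩ := hi
    have hMK := h3 M hM hmax
    have huM : u ≠ M := by rintro rfl; exact hMK huK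
    have hMI := hZ u hu M hM (hmax u hu huM) (h.le huK)
    have h1 := hfull M hM u hu huM.symm (h.ge hMI) hMK
    rw [Finset.erase_right_comm] at h1
    exact (not_incAt_ends hJc ((mem_sufSet hJ).1 huK)).2.2 M (by simp [hM, huM.symm])
      (fun z hz => hmax z (Finset.mem_of_mem_erase hz)) h1
  · by_contra hi
    obtain ⟨m, hm, hmin⟩ := exists_min_mem (Z := Z) (by
      by_contra he
      rw [Finset.not_nonempty_iff_eq_empty] at he
      subst he
      exact hi fun x hx => absurd hx (Finset.notMem_empty x))
    obtain ⟨-, h2, -⟩ := not_incAt_ends hL hi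
    unfold IncAt at hi
    push Not at hi
    obtain ⟨u, hu, v, hv, huv, huL, hvL⟩ := hi
    have hmL := h2 m hm hmin
    have hvm : v ≠ m := by rintro rfl; exact hvL hmL
    have hmI : Z.erase m ∉ I := fun h1 => hvL (h.ge (hZ m hm v hv (hmin v hv hvm) h1))
    have h1 := hfull m hm v hv hvm.symm hmL fun h1 => hmI (h.le h1)
    rw [Finset.erase_right_comm] at h1
    have hmv : m ∈ Z.erase v := by simp [hm, hvm.symm]
    refine hvL (Finset.mem_union_right _ (mem_fullSet.2
      ⟨mem_C_succ hmv ((realizable_iff.1 hJ).1 h1), fun x hx => ?_⟩))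
    by_cases hxm : x = m
    · exact hxm ▸ h1
    · exact incAt_of_notMem_sufSet_union_fullSet hJ hvL m hmv x hx
        (hmin x (Finset.mem_of_mem_erase hx) hxm) h1

theorem Between.exists_rank {n k : ℕ} {J I : Finset (Finset (Fin n))} (h : Between n k J I)
    (hI : Consistent I) : ∃ (U : Finset (Finset (Fin n))) (g : Finset (Fin n) → ℕ),
      (∀ Z, Z ∈ U ↔ ¬ IncAt I Z) ∧ ∀ Z : Finset (Fin n), ∀ x ∈ Z, ∀ y ∈ Z, x < y →
      (Z ∈ U → g (Z.erase x) < g (Z.erase y)) ∧ (Z ∉ U → g (Z.erase y) < g (Z.erase x)) := by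
  have hIr : Realizable n (k + 1) I := realizable_iff.2 ⟨h.subset_C, hI⟩
  obtain ⟨g, hg⟩ := (realizable_iff.1 (realizable_sufSet hIr)).2.exists_rank
  exact ⟨_, g, fun Z => mem_sufSet hIr, hg⟩

/-- Rank the candidates by the packet relation of `I_s` and take a minimal one. In every row the
upper bound has the direction of `I`, and the candidates that must enter before `X` have smaller
rank, so they are already in `I`. -/
theorem Between.exists_insert {n k : ℕ} {J I : Finset (Finset (Fin n))} (h : Between n k J I)
    (hJ : Realizable n k J) (hI : Consistent I) (hne : I ≠ sufSet n k J ∪ fullSet n k J) :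
    ∃ X ∈ fullSet n k J, X ∉ I ∧ Consistent (insert X I) := by
  obtain ⟨U, g, hU, hg⟩ := h.exists_rank hI
  have hn : ((sufSet n k J ∪ fullSet n k J) \ I).Nonempty := by
    rw [Finset.sdiff_nonempty]
    exact fun h1 => hne (h.ge.antisymm h1)
  obtain ⟨X, hX, hmin⟩ := Finset.exists_min_image _ g hn
  rw [Finset.mem_sdiff] at hX
  refine ⟨X, (Finset.mem_union.1 hX.1).resolve_left fun h1 => hX.2 (h.le h1), hX.2, fun Z => ?_⟩
  have key : ∀ A ∈ sufSet n k J ∪ fullSet n k J, g A < g X → A ∈ insert X I := by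
    intro A hA hAX
    by_contra h1
    rw [Finset.mem_insert, not_or] at h1
    exact absurd hAX (hmin A (Finset.mem_sdiff.2 ⟨hA, h1.2⟩)).not_gt
  by_cases hZ : Z ∈ U
  · refine Or.inr fun x hx y hy hxy hyI => ?_
    have hZ' := (hU Z).1 hZ
    have hlt := (hg Z x hx y hy hxy).1 hZ
    rcases Finset.mem_insert.1 hyI with h1 | h1
    · rw [h1] at hlt
      exact key _ ((h.decAt_of_mem_sufSet hJ hI hZ').2 x hx y hy hxy (h1 ▸ hX.1)) hlt
    · exact Finset.mem_insert_of_mem ((hI Z).resolve_left hZ' x hx y hy hxy h1)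
  · refine Or.inl fun x hx y hy hxy hxI => ?_
    have hZ' := not_not.1 fun h1 => hZ ((hU Z).2 h1)
    have hlt := (hg Z x hx y hy hxy).2 hZ
    rcases Finset.mem_insert.1 hxI with h1 | h1
    · rw [h1] at hlt
      exact key _ ((h.incAt_of_notMem_sufSet hJ hZ').2 x hx y hy hxy (h1 ▸ hX.1)) hlt
    · exact Finset.mem_insert_of_mem (hZ' x hx y hy hxy h1)

/-- Dual to `Between.exists_insert`: a removable element of maximal rank is followed in each row
only by elements of `J_s`, whose direction there would force it into `J_s` as well. -/
theorem Between.exists_erase {n k : ℕ} {J I : Finset (Finset (Fin n))} (h : Between n k J I)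
    (hJ : Realizable n k J) (hI : Consistent I) (hne : I ≠ sufSet n k J) :
    ∃ X ∈ fullSet n k J, X ∈ I ∧ X ∉ sufSet n k J ∧ Consistent (I.erase X) := by
  obtain ⟨U, g, hU, hg⟩ := h.exists_rank hI
  have hn : (I \ sufSet n k J).Nonempty := by
    rw [Finset.sdiff_nonempty]
    exact fun h1 => hne (h1.antisymm h.le)
  obtain ⟨X, hX, hmax⟩ := Finset.exists_max_image _ g hn
  rw [Finset.mem_sdiff] at hX
  refine ⟨X, (Finset.mem_union.1 (h.ge hX.1)).resolve_left hX.2, hX.1, hX.2, fun Z => ?_⟩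
  have key : ∀ A ∈ I, g X < g A → A ∈ sufSet n k J := by
    intro A hA hAX
    by_contra h1
    exact absurd hAX (hmax A (Finset.mem_sdiff.2 ⟨hA, h1⟩)).not_gt
  by_cases hZ : Z ∈ U
  · refine Or.inr fun x hx y hy hxy hyI => ?_
    have hZ' := (hU Z).1 hZ
    have hlt := (hg Z x hx y hy hxy).1 hZ
    have hyI' := Finset.mem_of_mem_erase hyI
    refine Finset.mem_erase.2 ⟨fun h1 => ?_, (hI Z).resolve_left hZ' x hx y hy hxy hyI'⟩
    rw [h1] at hlt
    exact hX.2 (h1 ▸ (h.decAt_of_mem_sufSet hJ hI hZ').1 x hx y hy hxy (key _ hyI' hlt))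
  · refine Or.inl fun x hx y hy hxy hxI => ?_
    have hZ' := not_not.1 fun h1 => hZ ((hU Z).2 h1)
    have hlt := (hg Z x hx y hy hxy).2 hZ
    have hxI' := Finset.mem_of_mem_erase hxI
    refine Finset.mem_erase.2 ⟨fun h1 => ?_, hZ' x hx y hy hxy hxI'⟩
    rw [h1] at hlt
    exact hX.2 (h1 ▸ (h.incAt_of_notMem_sufSet hJ hZ').1 x hx y hy hxy (key _ hxI' hlt))

/-! ### Admissible orders through positions -/

theorem pairwise_iff_idxOf {β : Type*} [DecidableEq β] {l : List β} (hl : l.Nodup)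
    (R : β → β → Prop) :
    l.Pairwise R ↔ ∀ a ∈ l, ∀ b ∈ l, l.idxOf a < l.idxOf b → R a b := by
  rw [List.pairwise_iff_getElem]
  constructor
  · intro h a ha b hb hab
    have := h _ _ (List.idxOf_lt_length_of_mem ha) (List.idxOf_lt_length_of_mem hb) hab
    simpa using this
  · intro h i j hi hj hij
    refine h _ (List.getElem_mem hi) _ (List.getElem_mem hj) ?_
    rwa [hl.idxOf_getElem, hl.idxOf_getElem]

theorem eq_of_pairwise_lt {β : Type*} {f : β → ℕ} {l l' : List β}
    (hm : ∀ a, a ∈ l ↔ a ∈ l') (h : l.Pairwise fun a b => f a < f b)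
    (h' : l'.Pairwise fun a b => f a < f b) : l = l' := by
  have hnd : ∀ s : List β, (s.Pairwise fun a b => f a < f b) → s.Nodup := fun s hs =>
    hs.imp fun hab => by rintro rfl; exact lt_irrefl _ hab
  have hp : l.Perm l' := (List.perm_ext_iff_of_nodup (hnd l h) (hnd l' h')).2 hm
  exact hp.eq_of_pairwise (fun a b _ _ h1 h2 => absurd h1 h2.asymm) h h'

theorem filter_eq_iff {β : Type*} [DecidableEq β] {ρ l : List β} (hρ : ρ.Nodup) {p : β → Bool}
    (hm : ∀ a, (a ∈ ρ ∧ p a) ↔ a ∈ l) :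
    ρ.filter p = l ↔ l.Pairwise fun a b => ρ.idxOf a < ρ.idxOf b := by
  have h0 : (ρ.filter p).Pairwise fun a b => ρ.idxOf a < ρ.idxOf b :=
    ((pairwise_iff_idxOf hρ _).2 fun _ _ _ _ h => h).sublist List.filter_sublist
  constructor
  · rintro rfl
    exact h0
  · exact fun h => eq_of_pairwise_lt (by simpa using hm) h0 h

theorem mem_inter {n : ℕ} {J : Finset (Finset (Fin n))} {X A : Finset (Fin n)} :
    A ∈ inter J X ↔ A ∈ lexPacket X ∧ A ∈ J := by
  simp [inter]

theorem filter_eq_inter_iff {n k : ℕ} {J : Finset (Finset (Fin n))} {ρ : List (Finset (Fin n))}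
    (hρ : ρ.Nodup) (hJ : ρ.toFinset = J) {X : Finset (Fin n)} (hX : X ∈ C n (k + 1)) :
    ρ.filter (· ∈ packet X) = inter J X ↔ ∀ x ∈ X, ∀ y ∈ X, x < y → X.erase x ∈ J →
      X.erase y ∈ J → ρ.idxOf (X.erase y) < ρ.idxOf (X.erase x) := by
  rw [filter_eq_iff hρ, inter, List.pairwise_filter, pairwise_lexPacket]
  · simp only [decide_eq_true_eq]
    exact ⟨fun h x hx y hy hxy h1 h2 => h x hx y hy hxy h2 h1,
      fun h x hx y hy hxy h1 h2 => h x hx y hy hxy h2 h1⟩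
  · intro A
    rw [mem_inter, mem_lexPacket (nonempty_of_mem_C hX), ← hJ, List.mem_toFinset,
      decide_eq_true_eq, and_comm]

theorem filter_eq_reverse_inter_iff {n k : ℕ} {J : Finset (Finset (Fin n))}
    {ρ : List (Finset (Fin n))} (hρ : ρ.Nodup) (hJ : ρ.toFinset = J) {X : Finset (Fin n)}
    (hX : X ∈ C n (k + 1)) :
    ρ.filter (· ∈ packet X) = (inter J X).reverse ↔ ∀ x ∈ X, ∀ y ∈ X, x < y → X.erase x ∈ J →
      X.erase y ∈ J → ρ.idxOf (X.erase x) < ρ.idxOf (X.erase y) := by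
  rw [filter_eq_iff hρ, List.pairwise_reverse, inter, List.pairwise_filter, pairwise_lexPacket]
  · simp only [decide_eq_true_eq]
    exact ⟨fun h x hx y hy hxy h1 h2 => h x hx y hy hxy h2 h1,
      fun h x hx y hy hxy h1 h2 => h x hx y hy hxy h2 h1⟩
  · intro A
    rw [List.mem_reverse, mem_inter, mem_lexPacket (nonempty_of_mem_C hX), ← hJ,
      List.mem_toFinset, decide_eq_true_eq, and_comm]

theorem inter_eq_lexPacket {n k : ℕ} {J : Finset (Finset (Fin n))} {X : Finset (Fin n)}
    (hX : X ∈ fullSet n k J) : inter J X = lexPacket X := by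
  by_contra h
  obtain ⟨x, hx, hxJ⟩ := (inter_ne_lexPacket_iff J X).1 h
  exact hxJ ((mem_fullSet.1 hX).2 x hx)

theorem reverse_inter_eq_antiPacket {n k : ℕ} {J : Finset (Finset (Fin n))} {X : Finset (Fin n)}
    (hX : X ∈ fullSet n k J) : (inter J X).reverse = antiPacket X := by
  rw [inter_eq_lexPacket hX, lexPacket, List.reverse_reverse]

theorem IsAdm.mem_iff {n k : ℕ} {J : Finset (Finset (Fin n))} {ρ : List (Finset (Fin n))}
    (h : IsAdm n k J ρ) {A : Finset (Fin n)} : A ∈ ρ ↔ A ∈ J := by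
  rw [← h.toFinset_eq, List.mem_toFinset]

theorem between_inv {n k : ℕ} {J : Finset (Finset (Fin n))} (ρ : List (Finset (Fin n))) :
    Between n k J (inv n k J ρ) :=
  ⟨Finset.subset_union_left, Finset.union_subset_union_right (Finset.filter_subset _ _)⟩

theorem IsAdm.idxOf_lt {n k : ℕ} {J : Finset (Finset (Fin n))} {ρ : List (Finset (Fin n))}
    (h : IsAdm n k J ρ) (hJ : Realizable n k J) {A B : Finset (Fin n)} (hA : A ∈ J) (hB : B ∈ J)
    (hAB : Edge (inv n k J ρ) A B) : ρ.idxOf A < ρ.idxOf B := by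
  obtain ⟨X, x, hx, y, hy, hxy, ⟨hX, rfl, rfl⟩ | ⟨hX, rfl, rfl⟩⟩ := hAB
  · have hXC := mem_C_succ hx ((realizable_iff.1 hJ).1 hA)
    refine (filter_eq_reverse_inter_iff h.nodup h.toFinset_eq hXC).1 ?_ x hx y hy hxy hA hB
    rcases Finset.mem_union.1 hX with h1 | h1
    · exact h.suf X h1
    · rw [Finset.mem_filter] at h1
      rw [reverse_inter_eq_antiPacket h1.1, h1.2]
  · have hXC := mem_C_succ hx ((realizable_iff.1 hJ).1 hB)
    refine (filter_eq_inter_iff h.nodup h.toFinset_eq hXC).1 ?_ x hx y hy hxy hB hA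
    rw [inv, Finset.mem_union, not_or, Finset.mem_filter, not_and] at hX
    by_cases hp : X ∈ preSet n k J
    · exact h.pre X hp
    · have hf : X ∈ fullSet n k J := by
        rw [mem_preSet hJ, not_not] at hp
        exact (Finset.mem_union.1 ((mem_sufSet_union_fullSet hJ).2 ⟨hp, x, hx, hB⟩)).resolve_left
          hX.1
      rw [inter_eq_lexPacket hf]
      exact (h.full X hf).resolve_right (hX.2 hf)

theorem Edge.ne {n : ℕ} {I : Finset (Finset (Fin n))} {A B : Finset (Fin n)} (h : Edge I A B) :
    A ≠ B := by
  obtain ⟨X, x, hx, y, hy, hxy, ⟨-, rfl, rfl⟩ | ⟨-, rfl, rfl⟩⟩ := h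
  · exact fun h => hxy.ne (Finset.erase_injOn X hx hy h)
  · exact fun h => hxy.ne' (Finset.erase_injOn X hy hx h)

theorem isAdm_of_idxOf_lt {n k : ℕ} {J I : Finset (Finset (Fin n))} (hk : 1 ≤ k)
    (hJ : Realizable n k J) (hI : Between n k J I) {ρ : List (Finset (Fin n))} (hρ : ρ.Nodup)
    (hρJ : ρ.toFinset = J) (h : ∀ A ∈ J, ∀ B ∈ J, Edge I A B → ρ.idxOf A < ρ.idxOf B) :
    IsAdm n k J ρ ∧ inv n k J ρ = I := by
  have hasc : ∀ X ∈ I, ρ.filter (· ∈ packet X) = (inter J X).reverse := fun X hX =>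
    (filter_eq_reverse_inter_iff hρ hρJ (hI.subset_C hX)).2 fun x hx y hy hxy h1 h2 =>
      h _ h1 _ h2 ⟨X, x, hx, y, hy, hxy, Or.inl ⟨hX, rfl, rfl⟩⟩
  have hdesc : ∀ X ∈ C n (k + 1), X ∉ I → ρ.filter (· ∈ packet X) = inter J X :=
    fun X hXC hX => (filter_eq_inter_iff hρ hρJ hXC).2 fun x hx y hy hxy h1 h2 =>
      h _ h2 _ h1 ⟨X, x, hx, y, hy, hxy, Or.inr ⟨hX, rfl, rfl⟩⟩
  refine ⟨⟨hρ, hρJ, fun X hX => hasc X (hI.le hX), fun X hX => hdesc X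
    (Finset.mem_filter.1 hX).1 fun h1 => (mem_preSet hJ).1 hX (hI.decAt hJ h1), fun X hX => ?_⟩, ?_⟩
  · by_cases hXI : X ∈ I
    · right
      rw [hasc X hXI, reverse_inter_eq_antiPacket hX]
    · left
      rw [hdesc X (fullSet_subset_C J hX) hXI, inter_eq_lexPacket hX]
  · ext X
    rw [inv, Finset.mem_union, Finset.mem_filter]
    constructor
    · rintro (h1 | ⟨h1, h2⟩)
      · exact hI.le h1
      · by_contra hXI
        have hXC := fullSet_subset_C J h1
        rw [← reverse_inter_eq_antiPacket h1, filter_eq_reverse_inter_iff hρ hρJ hXC] at h2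
        have h3 := (filter_eq_inter_iff hρ hρJ hXC).1 (hdesc X hXC hXI)
        -- Here `k ≥ 1` matters: with two deletions available, the two orders of the packet are
        -- different.
        have hc : 1 < X.card := by rw [mem_C.1 hXC]; omega
        obtain ⟨x, hx, y, hy, hxy⟩ := Finset.one_lt_card.1 hc
        have hf := (mem_fullSet.1 h1).2
        rcases lt_or_gt_of_ne hxy with h4 | h4
        · exact (h2 x hx y hy h4 (hf x hx) (hf y hy)).asymm (h3 x hx y hy h4 (hf x hx) (hf y hy))
        · exact (h2 y hy x hx h4 (hf y hy) (hf x hx)).asymm (h3 y hy x hx h4 (hf y hy) (hf x hx))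
    · intro hXI
      rw [or_iff_not_imp_left]
      intro hs
      have hf := (Finset.mem_union.1 (hI.ge hXI)).resolve_left hs
      exact ⟨hf, by rw [hasc X hXI, reverse_inter_eq_antiPacket hf]⟩

theorem isAdm_of_pairwise {n k : ℕ} {J I : Finset (Finset (Fin n))} (hk : 1 ≤ k)
    (hJ : Realizable n k J) (hI : Between n k J I) {ρ : List (Finset (Fin n))} (hρ : ρ.Nodup)
    (hρJ : ρ.toFinset = J) (h : ρ.Pairwise fun A B => ¬ Edge I B A) :
    IsAdm n k J ρ ∧ inv n k J ρ = I := by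
  refine isAdm_of_idxOf_lt hk hJ hI hρ hρJ fun A hA B hB hAB => ?_
  rw [pairwise_iff_idxOf hρ] at h
  rw [← hρJ, List.mem_toFinset] at hA hB
  rcases lt_trichotomy (ρ.idxOf A) (ρ.idxOf B) with h1 | h1 | h1
  · exact h1
  · exact absurd ((List.idxOf_inj hA).1 h1) hAB.ne
  · exact absurd hAB (h B hB A hA h1)

theorem IsAdm.consistent_inv {n k : ℕ} {J : Finset (Finset (Fin n))} {ρ : List (Finset (Fin n))}
    (h : IsAdm n k J ρ) (hJ : Realizable n k J) : Consistent (inv n k J ρ) :=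
  (between_inv ρ).consistent_of_lt hJ fun _ hA _ hB => h.idxOf_lt hJ hA hB

theorem exists_sorted_list {β : Type*} [DecidableEq β] (S : Finset β) (f : β → ℕ) :
    ∃ l : List β, l.Nodup ∧ l.toFinset = S ∧ l.Pairwise fun a b => f a ≤ f b := by
  have hp := List.mergeSort_perm S.toList (fun a b => decide (f a ≤ f b))
  refine ⟨S.toList.mergeSort fun a b => decide (f a ≤ f b), hp.nodup_iff.2 S.nodup_toList, ?_, ?_⟩
  · rw [List.toFinset_eq_of_perm _ _ hp, Finset.toList_toFinset]
  · refine (List.pairwise_mergeSort (le := fun a b => decide (f a ≤ f b)) ?_ ?_ _).imp ?_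
    · intro a b c
      simpa using le_trans
    · intro a b
      simpa using le_total _ _
    · intro a b hab
      simpa using hab

/-- Sort `J` by a rank function of `I`; acyclicity is what makes every such `I` an inversion set. -/
theorem Between.exists_isAdm {n k : ℕ} {J I : Finset (Finset (Fin n))} (hI : Between n k J I)
    (hk : 1 ≤ k) (hJ : Realizable n k J) (hIc : Consistent I) :
    ∃ ρ, IsAdm n k J ρ ∧ inv n k J ρ = I := by
  obtain ⟨f, hf⟩ := hIc.exists_rank_edge
  obtain ⟨ρ, h1, h2, h3⟩ := exists_sorted_list J f
  exact ⟨ρ, isAdm_of_pairwise hk hJ hI h1 h2 (h3.imp fun hAB hBA => (hf _ _ hBA).not_ge hAB)⟩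

/-! ### Elementary equivalence -/

/-- One interchange of neighbours that share no packet. -/
def SwapStep (n k : ℕ) (l l' : List (Finset (Fin n))) : Prop :=
  ∃ a b A B, ¬ SharePacket n k A B ∧ l = a ++ A :: B :: b ∧ l' = a ++ B :: A :: b

theorem SwapStep.filter_eq {n k : ℕ} {l l' : List (Finset (Fin n))} (h : SwapStep n k l l')
    {X : Finset (Fin n)} (hX : X ∈ C n (k + 1)) :
    l.filter (· ∈ packet X) = l'.filter (· ∈ packet X) := by
  obtain ⟨a, b, A, B, hs, rfl, rfl⟩ := h
  by_cases hA : A ∈ packet X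
  · have hB : B ∉ packet X := fun hB => hs ⟨X, hX, hA, hB⟩
    simp [List.filter_append, hA, hB]
  · simp [List.filter_append, List.filter_cons, hA]

theorem SwapStep.perm {n k : ℕ} {l l' : List (Finset (Fin n))} (h : SwapStep n k l l') :
    l.Perm l' := by
  obtain ⟨a, b, A, B, -, rfl, rfl⟩ := h
  exact (List.Perm.swap B A b).append_left a

theorem SwapStep.cons {n k : ℕ} {l l' : List (Finset (Fin n))} (h : SwapStep n k l l')
    (D : Finset (Fin n)) : SwapStep n k (D :: l) (D :: l') := by
  obtain ⟨a, b, A, B, hs, rfl, rfl⟩ := h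
  exact ⟨D :: a, b, A, B, hs, rfl, rfl⟩

theorem swapStep_cons {n k : ℕ} {l l' : List (Finset (Fin n))}
    (h : Relation.ReflTransGen (SwapStep n k) l l') (D : Finset (Fin n)) :
    Relation.ReflTransGen (SwapStep n k) (D :: l) (D :: l') :=
  h.lift _ fun _ _ h => h.cons D

theorem swapStep_move_front {n k : ℕ} (A : Finset (Fin n)) (v : List (Finset (Fin n))) :
    ∀ u : List (Finset (Fin n)), (∀ B ∈ u, ¬ SharePacket n k A B) →
      Relation.ReflTransGen (SwapStep n k) (A :: (u ++ v)) (u ++ A :: v)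
  | [], _ => Relation.ReflTransGen.refl
  | B :: u, h => by
    refine Relation.ReflTransGen.head (b := B :: A :: (u ++ v)) ⟨[], u ++ v, A, B,
      h B (by simp), rfl, rfl⟩ ?_
    exact swapStep_cons (swapStep_move_front A v u fun D hD => h D (by simp [hD])) B

theorem filter_eq_of_swapSteps {n k : ℕ} {l l' : List (Finset (Fin n))}
    (h : Relation.ReflTransGen (SwapStep n k) l l') {X : Finset (Fin n)} (hX : X ∈ C n (k + 1)) :
    l.filter (· ∈ packet X) = l'.filter (· ∈ packet X) := by
  induction h with
  | refl => rfl
  | tail _ h ih => exact ih.trans (h.filter_eq hX)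

/-- Whatever precedes the head `A` of `l` in `l'` shares no packet with `A`, or that packet would be
ordered differently in the two lists. So `A` can be moved to the front of `l'`, and one recurses. -/
theorem swapSteps_of_filter_eq {n k : ℕ} : ∀ l l' : List (Finset (Fin n)), l.Nodup → l.Perm l' →
    (∀ X ∈ C n (k + 1), l.filter (· ∈ packet X) = l'.filter (· ∈ packet X)) →
    Relation.ReflTransGen (SwapStep n k) l l'
  | [], l', _, hp, _ => by rw [List.nil_perm.1 hp]
  | A :: t, l', hnd, hp, hf => by
    obtain ⟨u, v, rfl⟩ := List.append_of_mem (hp.subset (List.mem_cons_self (a := A) (l := t)))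
    have hnd' := hp.nodup_iff.1 hnd
    have hu : ∀ B ∈ u, ¬ SharePacket n k A B := by
      rintro B hB ⟨X, hX, hA, hBX⟩
      have h := hf X hX
      rw [List.filter_cons_of_pos (by simpa using hA), List.filter_append] at h
      rcases hc : u.filter (· ∈ packet X) with _ | ⟨D, s⟩
      · exact List.filter_eq_nil_iff.1 hc B hB (by simpa using hBX)
      · rw [hc, List.cons_append, List.cons.injEq] at h
        have hD : A ∈ u := (List.mem_filter.1 (h.1 ▸ hc ▸ List.mem_cons_self :
          A ∈ u.filter (· ∈ packet X))).1
        exact (List.nodup_append.1 hnd').2.2 A hD A (by simp) rfl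
    have hmv := swapStep_move_front (k := k) A v u hu
    refine Relation.ReflTransGen.trans (swapStep_cons (swapSteps_of_filter_eq t (u ++ v)
      (List.nodup_cons.1 hnd).2 ?_ ?_) A) hmv
    · exact List.perm_cons A |>.1 (hp.trans List.perm_middle)
    · intro X hX
      have h := (hf X hX).trans (filter_eq_of_swapSteps hmv hX).symm
      by_cases hA : A ∈ packet X
      · rw [List.filter_cons_of_pos (by simpa using hA),
          List.filter_cons_of_pos (by simpa using hA)] at h
        exact (List.cons.inj h).2
      · rwa [List.filter_cons_of_neg (by simpa using hA),
          List.filter_cons_of_neg (by simpa using hA)] at h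

theorem IsAdm.of_swapStep {n k : ℕ} {J : Finset (Finset (Fin n))} {l l' : List (Finset (Fin n))}
    (h : IsAdm n k J l) (hs : SwapStep n k l l') : IsAdm n k J l' where
  nodup := hs.perm.nodup_iff.1 h.nodup
  toFinset_eq := (List.toFinset_eq_of_perm _ _ hs.perm).symm.trans h.toFinset_eq
  suf X hX := (hs.filter_eq (sufSet_subset_C J hX)).symm.trans (h.suf X hX)
  pre X hX := (hs.filter_eq (Finset.mem_filter.1 hX).1).symm.trans (h.pre X hX)
  full X hX := by
    rw [← hs.filter_eq (fullSet_subset_C J hX)]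
    exact h.full X hX

theorem proj_eq_of_swapSteps {n k : ℕ} {J : Finset (Finset (Fin n))} (ρ : Adm n k J)
    {l : List (Finset (Fin n))} (h : Relation.ReflTransGen (SwapStep n k) ρ.1 l) :
    ∃ hl : IsAdm n k J l, proj ρ = proj ⟨l, hl⟩ := by
  induction h with
  | refl => exact ⟨ρ.2, rfl⟩
  | tail _ hs ih =>
    obtain ⟨hl, he⟩ := ih
    exact ⟨hl.of_swapStep hs, he.trans (Quotient.sound (Relation.EqvGen.rel _ _ hs))⟩

theorem proj_eq_of_filter_eq {n k : ℕ} {J : Finset (Finset (Fin n))} (ρ ρ' : Adm n k J)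
    (h : ∀ X ∈ C n (k + 1), ρ.1.filter (· ∈ packet X) = ρ'.1.filter (· ∈ packet X)) :
    proj ρ = proj ρ' := by
  have hp : ρ.1.Perm ρ'.1 := (List.perm_ext_iff_of_nodup ρ.2.nodup ρ'.2.nodup).2 fun A => by
    rw [ρ.2.mem_iff, ρ'.2.mem_iff]
  exact (proj_eq_of_swapSteps ρ (swapSteps_of_filter_eq _ _ ρ.2.nodup hp h)).2

/-- An admissible order restricts to a packet according to its inversion set. -/
theorem IsAdm.filter_eq {n k : ℕ} {J : Finset (Finset (Fin n))} {ρ : List (Finset (Fin n))}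
    (h : IsAdm n k J ρ) (hJ : Realizable n k J) {X : Finset (Fin n)} (hX : X ∈ C n (k + 1)) :
    ρ.filter (· ∈ packet X) = if X ∈ inv n k J ρ then (inter J X).reverse else inter J X := by
  split_ifs with hI
  · exact (filter_eq_reverse_inter_iff h.nodup h.toFinset_eq hX).2 fun x hx y hy hxy h1 h2 =>
      h.idxOf_lt hJ h1 h2 ⟨X, x, hx, y, hy, hxy, Or.inl ⟨hI, rfl, rfl⟩⟩
  · exact (filter_eq_inter_iff h.nodup h.toFinset_eq hX).2 fun x hx y hy hxy h1 h2 =>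
      h.idxOf_lt hJ h2 h1 ⟨X, x, hx, y, hy, hxy, Or.inr ⟨hI, rfl, rfl⟩⟩

theorem proj_eq_of_inv_eq {n k : ℕ} {J : Finset (Finset (Fin n))} (hJ : Realizable n k J)
    (ρ ρ' : Adm n k J) (h : inv n k J ρ.1 = inv n k J ρ'.1) : proj ρ = proj ρ' :=
  proj_eq_of_filter_eq ρ ρ' fun X hX => by rw [ρ.2.filter_eq hJ hX, ρ'.2.filter_eq hJ hX, h]

/-! ### Packet flips -/

theorem erase_union_erase {n : ℕ} {X : Finset (Fin n)} {x y : Fin n} (hxy : x ≠ y) : X.erase x ∪ X.erase y = X := by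
  ext z
  simp only [Finset.mem_union, Finset.mem_erase]
  constructor
  · tauto
  · intro hz
    by_cases hzx : z = x
    · exact Or.inr ⟨hzx ▸ hxy, hz⟩
    · exact Or.inl ⟨hzx, hz⟩

theorem Edge.insert_iff {n : ℕ} {I : Finset (Finset (Fin n))} {X A B : Finset (Fin n)}
    (h : ¬ (A ∈ lexPacket X ∧ B ∈ lexPacket X)) : Edge (insert X I) A B ↔ Edge I A B := by
  refine exists_congr fun Y => exists_congr fun x => and_congr_right fun hx =>
    exists_congr fun y => and_congr_right fun hy => and_congr_right fun _ => ?_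
  by_cases hYX : Y = X
  · subst hYX
    have h1 : ∀ z ∈ Y, Y.erase z ∈ lexPacket Y := fun z hz => mem_lexPacket_iff.2 ⟨z, hz, rfl⟩
    constructor <;> rintro (⟨-, rfl, rfl⟩ | ⟨-, rfl, rfl⟩)
    · exact absurd ⟨h1 x hx, h1 y hy⟩ h
    · exact absurd ⟨h1 y hy, h1 x hx⟩ h
    · exact absurd ⟨h1 x hx, h1 y hy⟩ h
    · exact absurd ⟨h1 y hy, h1 x hx⟩ h
  · simp [Finset.mem_insert, hYX]

theorem not_edge_of_lt {n : ℕ} {I : Finset (Finset (Fin n))} {X : Finset (Fin n)} {x y : Fin n}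
    (hx : x ∈ X) (hy : y ∈ X) (hxy : x < y) :
    (X ∉ I → ¬ Edge I (X.erase x) (X.erase y)) ∧ (X ∈ I → ¬ Edge I (X.erase y) (X.erase x)) := by
  have h0 := erase_union_erase (X := X) hxy.ne
  have h0' := erase_union_erase (X := X) hxy.ne'
  constructor
  · rintro hX ⟨Y, u, hu, v, hv, huv, ⟨hY, h1, h2⟩ | ⟨hY, h1, h2⟩⟩
    · rw [h1, h2, erase_union_erase huv.ne] at h0
      exact hX (h0 ▸ hY)
    · rw [h1, h2, erase_union_erase huv.ne'] at h0
      subst h0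
      rw [Finset.erase_injOn Y hx hv h1, Finset.erase_injOn Y hy hu h2] at hxy
      exact hxy.asymm huv
  · rintro hX ⟨Y, u, hu, v, hv, huv, ⟨hY, h1, h2⟩ | ⟨hY, h1, h2⟩⟩
    · rw [h1, h2, erase_union_erase huv.ne] at h0'
      subst h0'
      rw [Finset.erase_injOn Y hy hu h1, Finset.erase_injOn Y hx hv h2] at hxy
      exact hxy.asymm huv
    · rw [h1, h2, erase_union_erase huv.ne'] at h0'
      exact hY (h0' ▸ hX)

theorem Between.insert {n k : ℕ} {J I : Finset (Finset (Fin n))} (hI : Between n k J I)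
    {X : Finset (Fin n)} (hX : X ∈ fullSet n k J) : Between n k J (insert X I) :=
  ⟨hI.le.trans (Finset.subset_insert _ _),
    Finset.insert_subset (Finset.mem_union_right _ hX) hI.ge⟩

theorem Between.erase {n k : ℕ} {J I : Finset (Finset (Fin n))} (hI : Between n k J I)
    {X : Finset (Fin n)} (hX : X ∉ sufSet n k J) : Between n k J (I.erase X) :=
  ⟨fun _ hY => Finset.mem_erase.2 ⟨fun h => hX (h ▸ hY), hI.le hY⟩,
    (Finset.erase_subset _ _).trans hI.ge⟩

/-- If `I` and `I ∪ {X}` are inversion sets, then they are related by a flip of `X`. -/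
theorem exists_flip {n k : ℕ} {J I : Finset (Finset (Fin n))} (hk : 1 ≤ k) (hJ : Realizable n k J)
    (hI : Between n k J I) (hIc : Consistent I) {X : Finset (Fin n)} (hX : X ∈ fullSet n k J)
    (hXI : X ∉ I) (hXc : Consistent (insert X I)) :
    ∃ a b : List (Finset (Fin n)),
      (IsAdm n k J (a ++ lexPacket X ++ b) ∧ inv n k J (a ++ lexPacket X ++ b) = I) ∧
      IsAdm n k J (a ++ antiPacket X ++ b) ∧ inv n k J (a ++ antiPacket X ++ b) = insert X I := by
  classical
  obtain ⟨ρ, hρ, hρI⟩ := hI.exists_isAdm hk hJ hIc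
  obtain ⟨σ, hσ, hσI⟩ := (hI.insert hX).exists_isAdm hk hJ hXc
  have hXJ : ∀ x ∈ X, X.erase x ∈ J := (mem_fullSet.1 hX).2
  have hPJ : ∀ A ∈ lexPacket X, A ∈ J := by
    intro A hA
    obtain ⟨x, hx, rfl⟩ := mem_lexPacket_iff.1 hA
    exact hXJ x hx
  have hlt : ∀ I', I' = I ∨ I' = insert X I → ∀ A ∈ J, ∀ B ∈ J,
      ¬ (A ∈ lexPacket X ∧ B ∈ lexPacket X) → Edge I' A B →
      ρ.idxOf A < ρ.idxOf B ∧ σ.idxOf A < σ.idxOf B := by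
    intro I' hI' A hA B hB hAB he
    have h1 : Edge I A B := by
      rcases hI' with rfl | rfl
      · exact he
      · exact (Edge.insert_iff hAB).1 he
    exact ⟨hρ.idxOf_lt hJ hA hB (hρI ▸ h1),
      hσ.idxOf_lt hJ hA hB (hσI ▸ (Edge.insert_iff hAB).2 h1)⟩
  -- The packet of `X` is ordered oppositely in `ρ` and `σ`, so no pair in it is ordered the same
  -- way by both.
  have hopp : ∀ A ∈ lexPacket X, ∀ B ∈ lexPacket X,
      ¬ (ρ.idxOf A < ρ.idxOf B ∧ σ.idxOf A < σ.idxOf B) := by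
    rintro A hA B hB ⟨h1, h2⟩
    obtain ⟨x, hx, rfl⟩ := mem_lexPacket_iff.1 hA
    obtain ⟨y, hy, rfl⟩ := mem_lexPacket_iff.1 hB
    rcases lt_trichotomy x y with h | rfl | h
    · refine h1.asymm (hρ.idxOf_lt hJ (hXJ y hy) (hXJ x hx) ?_)
      exact ⟨X, x, hx, y, hy, h, Or.inr ⟨hρI ▸ hXI, rfl, rfl⟩⟩
    · exact lt_irrefl _ h1
    · refine h2.asymm (hσ.idxOf_lt hJ (hXJ y hy) (hXJ x hx) ?_)
      exact ⟨X, y, hy, x, hx, h, Or.inl ⟨hσI ▸ Finset.mem_insert_self _ _, rfl, rfl⟩⟩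
  -- These go before the block, everything else after it. Edges not inside the packet are the same
  -- for `I` and `insert X I`, hence respected by both orders; an edge from the packet into `D`
  -- would give two packet members in the same order in both, against `hopp`.
  let D : Finset (Fin n) → Prop := fun B => B ∉ lexPacket X ∧
    ∃ E ∈ lexPacket X, ρ.idxOf B < ρ.idxOf E ∧ σ.idxOf B < σ.idxOf E
  let a := ρ.filter fun B => D B
  let b := ρ.filter fun B => ¬ D B ∧ B ∉ lexPacket X
  have ha : ∀ B, B ∈ a ↔ B ∈ J ∧ D B := fun B => by simp [a, hρ.mem_iff]
  have hb : ∀ B, B ∈ b ↔ B ∈ J ∧ ¬ D B ∧ B ∉ lexPacket X := fun B => by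
    simp only [b, List.mem_filter, hρ.mem_iff, decide_eq_true_eq]
  have hsub : ∀ l : List (Finset (Fin n)), l.Sublist ρ →
      l.Pairwise fun A B => ρ.idxOf A < ρ.idxOf B := fun l hl =>
    ((pairwise_iff_idxOf hρ.nodup fun A B => ρ.idxOf A < ρ.idxOf B).2
      fun _ _ _ _ h => h).sublist hl
  have main : ∀ I' M, I' = I ∨ I' = insert X I → (∀ A, A ∈ M ↔ A ∈ lexPacket X) → M.Nodup →
      M.Pairwise (fun A B => ¬ Edge I' B A) → (a ++ M ++ b).Nodup ∧
      (a ++ M ++ b).toFinset = J ∧ (a ++ M ++ b).Pairwise (fun A B => ¬ Edge I' B A) := by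
    intro I' M hI' hM hMn hMp
    refine ⟨?_, ?_, ?_⟩
    · rw [List.nodup_append, List.nodup_append]
      refine ⟨⟨hρ.nodup.filter _, hMn, ?_⟩, hρ.nodup.filter _, ?_⟩
      · rintro A hA B hB rfl
        exact ((ha A).1 hA).2.1 ((hM A).1 hB)
      · rintro A hA B hB rfl
        have h1 := (hb A).1 hB
        rcases List.mem_append.1 hA with h2 | h2
        · exact h1.2.1 ((ha A).1 h2).2
        · exact h1.2.2 ((hM A).1 h2)
    · ext A
      rw [List.mem_toFinset, List.mem_append, List.mem_append, ha, hb, hM]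
      have := hPJ A
      clear_value a b D
      tauto
    · rw [List.pairwise_append, List.pairwise_append]
      refine ⟨⟨?_, hMp, ?_⟩, ?_, ?_⟩
      · refine (hsub a List.filter_sublist).imp_of_mem fun {A B} hA hB hAB he => ?_
        exact hAB.asymm (hlt I' hI' B ((ha B).1 hB).1 A ((ha A).1 hA).1
          (fun h => ((ha A).1 hA).2.1 h.2) he).1
      · intro A hA B hB he
        obtain ⟨hAJ, hAP, E, hE, h1, h2⟩ := (ha A).1 hA
        rw [hM] at hB
        have h3 := hlt I' hI' B (hPJ B hB) A hAJ (fun h => hAP h.2) he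
        exact hopp B hB E hE ⟨h3.1.trans h1, h3.2.trans h2⟩
      · refine (hsub b List.filter_sublist).imp_of_mem fun {A B} hA hB hAB he => ?_
        exact hAB.asymm (hlt I' hI' B ((hb B).1 hB).1 A ((hb A).1 hA).1
          (fun h => ((hb A).1 hA).2.2 h.2) he).1
      · intro A hA B hB he
        obtain ⟨hBJ, hBD, hBP⟩ := (hb B).1 hB
        rcases List.mem_append.1 hA with h1 | h1
        · obtain ⟨hAJ, hAP, E, hE, h1, h2⟩ := (ha A).1 h1
          have h3 := hlt I' hI' B hBJ A hAJ (fun h => hAP h.2) he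
          exact hBD ⟨hBP, E, hE, h3.1.trans h1, h3.2.trans h2⟩
        · rw [hM] at h1
          exact hBD ⟨hBP, A, h1, hlt I' hI' B hBJ A (hPJ A h1) (fun h => hBP h.1) he⟩
  obtain ⟨m1, m2, m3⟩ := main I (lexPacket X) (Or.inl rfl) (fun _ => Iff.rfl) (nodup_lexPacket X)
    ((pairwise_lexPacket X _).2 fun x hx y hy hxy => (not_edge_of_lt hx hy hxy).1 hXI)
  obtain ⟨p1, p2, p3⟩ := main (insert X I) (antiPacket X) (Or.inr rfl)
    (fun A => by rw [mem_antiPacket_iff, mem_lexPacket_iff]) (nodup_antiPacket X)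
    ((pairwise_antiPacket X _).2 fun x hx y hy hxy =>
      (not_edge_of_lt hx hy hxy).2 (Finset.mem_insert_self _ _))
  exact ⟨a, b, isAdm_of_pairwise hk hJ hI m1 m2 m3,
    isAdm_of_pairwise hk hJ (hI.insert hX) p1 p2 p3⟩

/-! ### The second Bruhat order through inversion sets -/

theorem exists_proj {n k : ℕ} {J : Finset (Finset (Fin n))} (r : SecondBruhat n k J) :
    ∃ ρ : Adm n k J, r = proj ρ := by
  obtain ⟨ρ, hρ⟩ := Quotient.exists_rep r
  exact ⟨ρ, hρ.symm⟩

theorem inv_proj {n k : ℕ} {J : Finset (Finset (Fin n))} (ρ : Adm n k J) :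
    (proj ρ).inv = inv n k J ρ.1 := rfl

theorem inv_injective {n k : ℕ} {J : Finset (Finset (Fin n))} (hJ : Realizable n k J) :
    Function.Injective (SecondBruhat.inv : SecondBruhat n k J → _) := by
  intro r r' h
  obtain ⟨ρ, rfl⟩ := exists_proj r
  obtain ⟨ρ', rfl⟩ := exists_proj r'
  exact proj_eq_of_inv_eq hJ ρ ρ' h

theorem SecondBruhat.between {n k : ℕ} {J : Finset (Finset (Fin n))} (r : SecondBruhat n k J) :
    Between n k J r.inv := by
  obtain ⟨ρ, rfl⟩ := exists_proj r
  exact between_inv ρ.1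

theorem SecondBruhat.consistent {n k : ℕ} {J : Finset (Finset (Fin n))} (hJ : Realizable n k J)
    (r : SecondBruhat n k J) : Consistent r.inv := by
  obtain ⟨ρ, rfl⟩ := exists_proj r
  exact ρ.2.consistent_inv hJ

theorem Between.exists_inv_eq {n k : ℕ} {J I : Finset (Finset (Fin n))} (hI : Between n k J I)
    (hk : 1 ≤ k) (hJ : Realizable n k J) (hIc : Consistent I) :
    ∃ r : SecondBruhat n k J, r.inv = I := by
  obtain ⟨ρ, hρ, h⟩ := hI.exists_isAdm hk hJ hIc
  exact ⟨proj ⟨ρ, hρ⟩, h⟩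

/-- Distinct packets share at most one set, so reversing the block of `X` changes no other packet;
the converse is `exists_flip`. -/
theorem flipUp_iff {n k : ℕ} {J : Finset (Finset (Fin n))} (hk : 1 ≤ k) (hJ : Realizable n k J)
    {r r' : SecondBruhat n k J} :
    FlipUp r r' ↔ ∃ X ∈ fullSet n k J, X ∉ r.inv ∧ r'.inv = insert X r.inv := by
  constructor
  · intro h
    obtain ⟨Y, hY, hYr⟩ := Finset.exists_of_ssubset h.inv_ssubset
    have hss := h.inv_ssubset.subset
    obtain ⟨ρ, ρ', X, a, b, rfl, rfl, hX, hXr, h1, h2⟩ := h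
    have key : ∀ Z ∈ (proj ρ').inv, Z ∉ (proj ρ).inv → Z = X := by
      intro Z hZ hZr
      by_contra hne
      rw [inv_proj, inv, Finset.mem_union, Finset.mem_filter] at hZ hZr
      rw [not_or, not_and] at hZr
      obtain ⟨hZF, hZe⟩ := hZ.resolve_left hZr.1
      refine hZr.2 hZF ?_
      rw [← hZe, h1, h2]
      simp only [List.filter_append]
      rw [filter_packet_short (fullSet_subset_C J hX) (fullSet_subset_C J hZF) (Ne.symm hne)]
    refine ⟨X, hX, hXr, ?_⟩
    have hXr' : X ∈ (proj ρ').inv := key Y hY hYr ▸ hY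
    ext Z
    rw [Finset.mem_insert]
    constructor
    · intro hZ
      rw [or_iff_not_imp_right]
      exact key Z hZ
    · rintro (rfl | hZ)
      · exact hXr'
      · exact hss hZ
  · rintro ⟨X, hX, hXr, he⟩
    obtain ⟨a, b, ⟨h1, h2⟩, h3, h4⟩ := exists_flip hk hJ r.between (r.consistent hJ) hX hXr
      (he ▸ r'.consistent hJ)
    refine ⟨⟨_, h1⟩, ⟨_, h3⟩, X, a, b, inv_injective hJ h2.symm, inv_injective hJ ?_, hX, hXr,
      rfl, rfl⟩
    rw [he]
    exact h4.symm

theorem inv_subset_of_le {n k : ℕ} {J : Finset (Finset (Fin n))} {r r' : SecondBruhat n k J}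
    (h : r ≤ r') : r.inv ⊆ r'.inv := inv_subset_of_flips h

theorem FlipUp.le {n k : ℕ} {J : Finset (Finset (Fin n))} {r r' : SecondBruhat n k J}
    (h : FlipUp r r') : r ≤ r' := Relation.ReflTransGen.single h

theorem exists_bot {n k : ℕ} {J : Finset (Finset (Fin n))} (hk : 1 ≤ k) (hJ : Realizable n k J) :
    ∃ r₀ : SecondBruhat n k J, r₀.inv = sufSet n k J ∧ ∀ r, r₀ ≤ r := by
  have hK := (realizable_iff.1 (realizable_sufSet hJ)).2
  obtain ⟨r₀, hr₀⟩ := Between.exists_inv_eq (I := sufSet n k J)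
    ⟨subset_rfl, Finset.subset_union_left⟩ hk hJ hK
  refine ⟨r₀, hr₀, fun r => ?_⟩
  induction hc : r.inv.card using Nat.strong_induction_on generalizing r with
  | _ N ih =>
    by_cases hr : r.inv = sufSet n k J
    · exact (inv_injective hJ (hr₀.trans hr.symm)).le
    · obtain ⟨X, hX, hXr, hXs, hXc⟩ := r.between.exists_erase hJ (r.consistent hJ) hr
      obtain ⟨r', hr'⟩ := (r.between.erase hXs).exists_inv_eq hk hJ hXc
      have hlt : r'.inv.card < N := by
        rw [hr', ← hc]
        exact Finset.card_erase_lt_of_mem hXr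
      refine (ih _ hlt r' rfl).trans (FlipUp.le ((flipUp_iff hk hJ).2 ⟨X, hX, ?_, ?_⟩))
      · rw [hr']
        exact Finset.notMem_erase _ _
      · rw [hr', Finset.insert_erase hXr]

theorem exists_top {n k : ℕ} {J : Finset (Finset (Fin n))} (hk : 1 ≤ k) (hJ : Realizable n k J) :
    ∃ r₁ : SecondBruhat n k J, r₁.inv = sufSet n k J ∪ fullSet n k J ∧ ∀ r, r ≤ r₁ := by
  have hL := (realizable_iff.1 (realizable_sufSet_union_fullSet hJ)).2
  obtain ⟨r₁, hr₁⟩ := Between.exists_inv_eq (I := sufSet n k J ∪ fullSet n k J)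
    ⟨Finset.subset_union_left, subset_rfl⟩ hk hJ hL
  refine ⟨r₁, hr₁, fun r => ?_⟩
  induction hc : (r₁.inv.card - r.inv.card) using Nat.strong_induction_on generalizing r with
  | _ N ih =>
    by_cases hr : r.inv = sufSet n k J ∪ fullSet n k J
    · exact (inv_injective hJ (hr.trans hr₁.symm)).le
    · obtain ⟨X, hX, hXr, hXc⟩ := r.between.exists_insert hJ (r.consistent hJ) hr
      obtain ⟨r', hr'⟩ := (r.between.insert hX).exists_inv_eq hk hJ hXc
      have hle : r'.inv.card ≤ r₁.inv.card := Finset.card_le_card (hr₁ ▸ r'.between.ge)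
      have hcard : r'.inv.card = r.inv.card + 1 := by
        rw [hr', Finset.card_insert_of_notMem hXr]
      exact (FlipUp.le ((flipUp_iff hk hJ).2 ⟨X, hX, hXr, hr'⟩)).trans (ih _ (by omega) r' rfl)

/-! ### Admissibility through initial segments -/

/-- Along each row the positions increase in the direction towards which `J` thins out, so cutting
at a position leaves an interval at the same end. -/
theorem IsAdm.consistent_prefix {n k : ℕ} {J : Finset (Finset (Fin n))}
    {ρ : List (Finset (Fin n))} (h : IsAdm n k J ρ) (hJ : Realizable n k J) (m : ℕ) :
    Consistent (J.filter fun A => ρ.idxOf A < m) := by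
  intro Z
  by_cases hZ : Z ∈ inv n k J ρ
  · refine Or.inr fun x hx y hy hxy hyQ => ?_
    rw [Finset.mem_filter] at hyQ ⊢
    have hxJ := (between_inv ρ).decAt hJ hZ x hx y hy hxy hyQ.1
    exact ⟨hxJ, (h.idxOf_lt hJ hxJ hyQ.1
      ⟨Z, x, hx, y, hy, hxy, Or.inl ⟨hZ, rfl, rfl⟩⟩).trans hyQ.2⟩
  · refine Or.inl fun x hx y hy hxy hxQ => ?_
    rw [Finset.mem_filter] at hxQ ⊢
    have hyJ := (between_inv ρ).incAt hJ hZ x hx y hy hxy hxQ.1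
    exact ⟨hyJ, (h.idxOf_lt hJ hyJ hxQ.1
      ⟨Z, x, hx, y, hy, hxy, Or.inr ⟨hZ, rfl, rfl⟩⟩).trans hxQ.2⟩

/-- An injective function on a row all of whose sublevel sets are intervals at one end of the row is
monotone. -/
theorem lt_of_sublevels {α : Type*} [LinearOrder α] {Z : Finset α} {g : α → ℕ}
    (hg : ∀ x ∈ Z, ∀ y ∈ Z, g x = g y → x = y)
    (h : ∀ m, (∀ x ∈ Z, ∀ y ∈ Z, x < y → g x < m → g y < m) ∨
      (∀ x ∈ Z, ∀ y ∈ Z, x < y → g y < m → g x < m))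
    {u v x y : α} (hu : u ∈ Z) (hv : v ∈ Z) (hx : x ∈ Z) (hy : y ∈ Z) (huv : u < v)
    (hguv : g u < g v) (hxy : x < y) : g x < g y := by
  have three : ∀ a ∈ Z, ∀ b ∈ Z, ∀ c ∈ Z, a < b → b < c →
      (g a < g b ∧ g b < g c) ∨ (g c < g b ∧ g b < g a) := by
    intro a ha b hb c hc hab hbc
    have n1 : g a ≠ g b := fun h => hab.ne (hg a ha b hb h)
    have n2 : g b ≠ g c := fun h => hbc.ne (hg b hb c hc h)
    -- The level `g b` just excludes `b`, so `b` is not the largest of the three values; the level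
    -- `g b + 1` just includes it, so it is not the smallest. Hence every triple is monotone.
    rcases h (g b) with h1 | h1 <;> rcases h (g b + 1) with h2 | h2
    · have := h1 a ha b hb hab
      have := h2 b hb c hc hbc
      omega
    · have := h1 a ha b hb hab
      have := h2 a ha b hb hab
      omega
    · have := h1 b hb c hc hbc
      have := h2 b hb c hc hbc
      omega
    · have := h1 b hb c hc hbc
      have := h2 a ha b hb hab
      omega
  have hne : g x ≠ g y := fun h => hxy.ne (hg x hx y hy h)
  by_contra hlt
  have hlt' : g y < g x := by omega
  have hyv : y ≠ v ∨ x ≠ u := by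
    by_contra! hc
    rw [hc.1, hc.2] at hlt'
    exact hlt'.asymm hguv
  have r1 : ∀ z ∈ Z, v < z → g v < g z := fun z hz hvz => by
    have := three u hu v hv z hz huv hvz
    omega
  have r2 : ∀ z ∈ Z, z < u → g z < g u := fun z hz hzu => by
    have := three z hz u hu v hv hzu huv
    omega
  have r3 : ∀ z ∈ Z, u < z → z < v → g u < g z ∧ g z < g v := fun z hz h1 h2 => by
    have := three u hu z hz v hv h1 h2
    omega
  have r4 : ∀ z ∈ Z, u < z → g u < g z := fun z hz h1 => by
    rcases lt_trichotomy z v with h2 | rfl | h2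
    · exact (r3 z hz h1 h2).1
    · exact hguv
    · exact hguv.trans (r1 z hz h2)
  rcases lt_trichotomy x u with h1 | rfl | h1
  · rcases lt_trichotomy y u with h2 | rfl | h2
    · have := three x hx y hy u hu hxy h2
      have := r2 x hx h1
      omega
    · exact hlt'.asymm (r2 x hx h1)
    · have := r4 y hy h2
      have := r2 x hx h1
      omega
  · exact hlt'.asymm (r4 y hy hxy)
  · have := three u hu x hx y hy h1 hxy
    have := r4 x hx h1
    omega

/-- The inversion set is guessed as `J_s` plus the full packets with some ascending pair. Full rows
are monotone by `lt_of_sublevels`; in the others a deletion outside `J` serves as the third point of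
a betweenness argument. -/
theorem isAdm_of_consistent_prefix {n k : ℕ} {J : Finset (Finset (Fin n))} (hk : 1 ≤ k)
    (hJ : Realizable n k J) {ρ : List (Finset (Fin n))} (hρ : ρ.Nodup) (hρJ : ρ.toFinset = J)
    (h : ∀ m, Consistent (J.filter fun A => ρ.idxOf A < m)) : IsAdm n k J ρ := by
  classical
  have hinj : ∀ A ∈ J, ∀ B, ρ.idxOf A = ρ.idxOf B → A = B := fun A hA B he =>
    (List.idxOf_inj (by rwa [← List.mem_toFinset, hρJ])).1 he
  have herase : ∀ X : Finset (Fin n), ∀ x ∈ X, ∀ y ∈ X, x < y → X.erase x ∈ J →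
      ρ.idxOf (X.erase x) ≠ ρ.idxOf (X.erase y) := fun X x hx y hy hxy hxJ he =>
    hxy.ne (Finset.erase_injOn X hx hy (hinj _ hxJ _ he))
  let I := sufSet n k J ∪ (fullSet n k J).filter fun X =>
    ∃ x ∈ X, ∃ y ∈ X, x < y ∧ ρ.idxOf (X.erase x) < ρ.idxOf (X.erase y)
  have hI : Between n k J I :=
    ⟨Finset.subset_union_left, Finset.union_subset_union_right (Finset.filter_subset _ _)⟩
  refine (isAdm_of_idxOf_lt hk hJ hI hρ hρJ ?_).1
  rintro A hA B hB ⟨X, x, hx, y, hy, hxy, ⟨hX, rfl, rfl⟩ | ⟨hX, rfl, rfl⟩⟩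
  · rcases Finset.mem_union.1 hX with hs | hf
    · by_contra hlt
      have hlt' : ρ.idxOf (X.erase y) < ρ.idxOf (X.erase x) :=
        lt_of_le_of_ne (not_lt.1 hlt) (herase X x hx y hy hxy hA).symm
      obtain ⟨M, hM, hmax⟩ := exists_max_mem ⟨x, hx⟩
      have hMJ := (not_incAt_ends (realizable_iff.1 hJ).2 ((mem_sufSet hJ).1 hs)).2.2 M hM hmax
      have hyM : y ≠ M := by rintro rfl; exact hMJ hB
      -- The segment strictly before `X.erase x` would contain the middle deletion `y` but neither
      -- `x` nor `M`.
      have h1 := ((h (ρ.idxOf (X.erase x))).three hx hy hM hxy (hmax y hy hyM)).1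
        (Finset.mem_filter.2 ⟨hB, hlt'⟩)
      simp only [Finset.mem_filter, lt_irrefl, and_false, hMJ, false_and, or_self] at h1
    · rw [Finset.mem_filter] at hf
      obtain ⟨hf, u, hu, v, hv, huv, hlt⟩ := hf
      have hf' := (mem_fullSet.1 hf).2
      refine lt_of_sublevels (Z := X) (g := fun z => ρ.idxOf (X.erase z))
        (fun s hs t ht he => Finset.erase_injOn X hs ht (hinj _ (hf' s hs) _ he)) (fun m => ?_)
        hu hv hx hy huv hlt hxy
      refine (h m X).imp (fun h1 s hs t ht hst hlt => ?_) fun h1 s hs t ht hst hlt => ?_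
      · exact (Finset.mem_filter.1 (h1 s hs t ht hst (Finset.mem_filter.2 ⟨hf' s hs, hlt⟩))).2
      · exact (Finset.mem_filter.1 (h1 s hs t ht hst (Finset.mem_filter.2 ⟨hf' t ht, hlt⟩))).2
  · have hinc := hI.incAt hJ hX
    by_contra hlt
    have hlt' : ρ.idxOf (X.erase x) < ρ.idxOf (X.erase y) :=
      lt_of_le_of_ne (not_lt.1 hlt) (herase X x hx y hy hxy hB)
    by_cases hf : ∀ z ∈ X, X.erase z ∈ J
    · have hXC := mem_C_succ hx ((realizable_iff.1 hJ).1 hB)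
      exact hX (Finset.mem_union_right _ (Finset.mem_filter.2
        ⟨mem_fullSet.2 ⟨hXC, hf⟩, x, hx, y, hy, hxy, hlt'⟩))
    · push Not at hf
      obtain ⟨z, hz, hzJ⟩ := hf
      have hzx : z < x := by
        rcases lt_trichotomy z x with h1 | rfl | h1
        · exact h1
        · exact absurd hB hzJ
        · exact absurd (hinc x hx z hz h1 hB) hzJ
      -- The segment strictly before `X.erase y` would contain the middle deletion `x` but neither
      -- `z` nor `y`.
      have h1 := ((h (ρ.idxOf (X.erase y))).three hz hx hy hzx hxy).1
        (Finset.mem_filter.2 ⟨hB, hlt'⟩)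
      simp only [Finset.mem_filter, lt_irrefl, and_false, hzJ, false_and, or_self] at h1

/-! ### Maximal chains of the second Bruhat order -/

theorem inv_total_of_mem_flag {n k : ℕ} {J : Finset (Finset (Fin n))} (c : Flag (SecondBruhat n k J))
    {r r' : SecondBruhat n k J} (hr : r ∈ c) (hr' : r' ∈ c) :
    r.inv ⊆ r'.inv ∨ r'.inv ⊆ r.inv :=
  (c.le_or_le hr hr').imp inv_subset_of_le inv_subset_of_le

theorem finite_secondBruhat {n k : ℕ} {J : Finset (Finset (Fin n))} (hJ : Realizable n k J) :
    Finite (SecondBruhat n k J) :=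
  Finite.of_injective _ (inv_injective hJ)

/-- Otherwise `X` and `Y` enter together, between the last chain member `u` without `X` and the
first member `v` with it. The first flip on a path from `u` to `v` is comparable to the whole chain,
so it lies in it by maximality; yet it adds only one element. -/
theorem exists_separating_of_flag {n k : ℕ} {J : Finset (Finset (Fin n))} (hk : 1 ≤ k)
    (hJ : Realizable n k J) (c : Flag (SecondBruhat n k J)) {X Y : Finset (Fin n)}
    (hX : X ∈ fullSet n k J) (hXY : X ≠ Y) :
    ∃ r ∈ c, (X ∈ r.inv ∧ Y ∉ r.inv) ∨ (Y ∈ r.inv ∧ X ∉ r.inv) := by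
  by_contra! hc
  have hiff : ∀ r ∈ c, X ∈ r.inv ↔ Y ∈ r.inv := fun r hr =>
    ⟨fun h => by_contra fun h' => h' ((hc r hr).1 h), fun h => (hc r hr).2 h⟩
  have := finite_secondBruhat hJ
  obtain ⟨r₀, hr₀, hbot⟩ := exists_bot hk hJ
  obtain ⟨r₁, hr₁, htop⟩ := exists_top hk hJ
  have h0c : r₀ ∈ c := Flag.mem_iff_forall_le_or_ge.2 fun s _ => Or.inl (hbot s)
  have h1c : r₁ ∈ c := Flag.mem_iff_forall_le_or_ge.2 fun s _ => Or.inr (htop s)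
  obtain ⟨u, ⟨huc, huX⟩, humax⟩ := Set.exists_max_image {r | r ∈ c ∧ X ∉ r.inv}
    (fun r => r.inv.card) (Set.toFinite _)
    ⟨r₀, h0c, fun h => disjoint_sufSet_fullSet hJ (hr₀ ▸ h) hX⟩
  obtain ⟨v, ⟨hvc, hvX⟩, hvmin⟩ := Set.exists_min_image {r | r ∈ c ∧ X ∈ r.inv}
    (fun r => r.inv.card) (Set.toFinite _) ⟨r₁, h1c, hr₁ ▸ Finset.mem_union_right _ hX⟩
  have hu : ∀ s ∈ c, X ∉ s.inv → s ≤ u := fun s hs hsX => by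
    rcases c.le_or_le hs huc with h | h
    · exact h
    · exact (inv_injective hJ (Finset.eq_of_subset_of_card_le (inv_subset_of_le h)
        (humax s ⟨hs, hsX⟩))).ge
  have hv : ∀ s ∈ c, X ∈ s.inv → v ≤ s := fun s hs hsX => by
    rcases c.le_or_le hvc hs with h | h
    · exact h
    · exact (inv_injective hJ (Finset.eq_of_subset_of_card_le (inv_subset_of_le h)
        (hvmin s ⟨hs, hsX⟩))).ge
  have huv : u ≤ v := (c.le_or_le huc hvc).resolve_right
    fun h => huX (inv_subset_of_le h hvX)
  rcases Relation.ReflTransGen.cases_head huv with rfl | ⟨w, huw, hwv⟩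
  · exact huX hvX
  · have hwc : w ∈ c := Flag.mem_iff_forall_le_or_ge.2 fun s hs => by
      by_cases hsX : X ∈ s.inv
      · exact Or.inl (le_trans (show w ≤ v from hwv) (hv s hs hsX))
      · exact Or.inr ((hu s hs hsX).trans huw.le)
    have hwX : X ∈ w.inv := by
      by_contra h
      exact huw.inv_ssubset.2 (inv_subset_of_le (hu w hwc h))
    have hwY := (hiff w hwc).1 hwX
    have huY : Y ∉ u.inv := fun h => huX ((hiff u huc).2 h)
    obtain ⟨W, -, -, hW⟩ := (flipUp_iff hk hJ).1 huw
    rw [hW, Finset.mem_insert] at hwX hwY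
    exact hXY ((hwX.resolve_right huX).trans (hwY.resolve_right huY).symm)

theorem existsUnique_induces {n k : ℕ} {J : Finset (Finset (Fin n))} (hk : 1 ≤ k)
    (hJ : Realizable n k J) (c : Flag (SecondBruhat n k J)) : ∃! l, Induces c l := by
  have := finite_secondBruhat hJ
  -- The time at which `X` enters the chain.
  let f : Finset (Fin n) → ℕ := fun X => {r | r ∈ c ∧ X ∉ r.inv}.ncard
  have hf : ∀ X Y, (∃ r ∈ c, X ∈ r.inv ∧ Y ∉ r.inv) → f X < f Y := by
    rintro X Y ⟨r, hr, hXr, hYr⟩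
    refine Set.ncard_lt_ncard ⟨?_, fun h => (h ⟨hr, hYr⟩ : r ∈ c ∧ X ∉ r.inv).2 hXr⟩ (Set.toFinite _)
    rintro s ⟨hs, hsX⟩
    refine ⟨hs, fun hsY => ?_⟩
    rcases inv_total_of_mem_flag c hs hr with h | h
    · exact hYr (h hsY)
    · exact hsX (h hXr)
  obtain ⟨l, hl, hlF, hlp⟩ := exists_sorted_list (fullSet n k J) f
  have hmem : ∀ {X}, X ∈ l ↔ X ∈ fullSet n k J := fun {X} => by rw [← hlF, List.mem_toFinset]
  rw [pairwise_iff_idxOf hl] at hlp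
  refine ⟨l, ⟨hl, hlF, fun X hX Y hY => ⟨fun h => ?_, fun h => ?_⟩⟩, ?_⟩
  · have hXY : X ≠ Y := by rintro rfl; exact lt_irrefl _ h
    obtain ⟨r, hr, h1 | h1⟩ := exists_separating_of_flag hk hJ c hX hXY
    · exact ⟨r, hr, h1⟩
    · exact absurd (hf Y X ⟨r, hr, h1⟩) (hlp X (hmem.2 hX) Y (hmem.2 hY) h).not_gt
  · have h1 := hf X Y h
    rcases lt_trichotomy (l.idxOf X) (l.idxOf Y) with h2 | h2 | h2
    · exact h2
    · rw [(List.idxOf_inj (hmem.2 hX)).1 h2] at h1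
      exact absurd h1 (lt_irrefl _)
    · exact absurd h1 (hlp Y (hmem.2 hY) X (hmem.2 hX) h2).not_gt
  · rintro l' ⟨hl', hlF', hlc'⟩
    have hmem' : ∀ {X}, X ∈ l' ↔ X ∈ fullSet n k J := fun {X} => by
      rw [← hlF', List.mem_toFinset]
    refine eq_of_pairwise_lt (f := l'.idxOf) (fun X => by rw [hmem, hmem'])
      ((pairwise_iff_idxOf hl' _).2 fun _ _ _ _ h => h) ((pairwise_iff_idxOf hl _).2 ?_)
    intro X hX Y hY h
    rw [hmem] at hX hY
    refine (hlc' X hX Y hY).2 ?_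
    have hXY : X ≠ Y := by rintro rfl; exact lt_irrefl _ h
    obtain ⟨r, hr, h1 | h1⟩ := exists_separating_of_flag hk hJ c hX hXY
    · exact ⟨r, hr, h1⟩
    · exact absurd (hf Y X ⟨r, hr, h1⟩) (hlp X (hmem.2 hX) Y (hmem.2 hY) h).not_gt

theorem Induces.consistent_prefix {n k : ℕ} {J : Finset (Finset (Fin n))}
    {c : Flag (SecondBruhat n k J)} {l : List (Finset (Fin n))} (h : Induces c l)
    (hJ : Realizable n k J) (m : ℕ) :
    Consistent (sufSet n k J ∪ (fullSet n k J).filter fun X => l.idxOf X < m) := by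
  obtain ⟨hl, hlF, hlc⟩ := h
  have hmem : ∀ {X}, X ∈ l ↔ X ∈ fullSet n k J := fun {X} => by rw [← hlF, List.mem_toFinset]
  rcases m with _ | m
  · simpa using (realizable_iff.1 (realizable_sufSet hJ)).2
  -- A chain member separating the consecutive entries `l[m]` and `l[m + 1]` has exactly this set as
  -- inversion set; past the end the set is `J_s ∪ J_F`.
  by_cases hm : m + 1 < l.length
  · have hX := hmem.1 (List.getElem_mem (by omega : m < l.length))
    have hY := hmem.1 (List.getElem_mem hm)
    obtain ⟨r, hr, hXr, hYr⟩ := (hlc _ hX _ hY).1 (by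
      rw [hl.idxOf_getElem, hl.idxOf_getElem]; omega)
    have he : sufSet n k J ∪ (fullSet n k J).filter (fun X => l.idxOf X < m + 1) = r.inv := by
      ext W
      rw [Finset.mem_union, Finset.mem_filter]
      constructor
      · rintro (hW | ⟨hW, hlt⟩)
        · exact r.between.le hW
        · by_contra hWr
          have := (hlc _ hX _ hW).2 ⟨r, hr, hXr, hWr⟩
          rw [hl.idxOf_getElem] at this
          omega
      · intro hWr
        rw [or_iff_not_imp_left]
        intro hs
        have hW := (Finset.mem_union.1 (r.between.ge hWr)).resolve_left hs
        have := (hlc _ hW _ hY).2 ⟨r, hr, hWr, hYr⟩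
        rw [hl.idxOf_getElem] at this
        exact ⟨hW, this⟩
    rw [he]
    exact r.consistent hJ
  · rw [Finset.filter_true_of_mem fun X hX => by
      have := List.idxOf_lt_length_of_mem (hmem.2 hX)
      omega]
    exact (realizable_iff.1 (realizable_sufSet_union_fullSet hJ)).2

/-! ### Orders listing `J_s` before `J_F` -/

/-- Initial segments of `s ++ l` are those of `s`, or `J_s` together with those of `l`; both kinds
are consistent. -/
theorem isAdm_append {n k : ℕ} {J : Finset (Finset (Fin n))}
    (hJ : Realizable n k J) {s l : List (Finset (Fin n))} (hs : IsAdm n (k + 1) (sufSet n k J) s)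
    (hl : l.Nodup) (hlF : l.toFinset = fullSet n k J)
    (h : ∀ m, Consistent (sufSet n k J ∪ (fullSet n k J).filter fun X => l.idxOf X < m)) :
    s ++ l ∈ sufFirstOrders n k J := by
  have hmem : ∀ {X}, X ∈ l ↔ X ∈ fullSet n k J := fun {X} => by rw [← hlF, List.mem_toFinset]
  have hidx1 : ∀ X ∈ sufSet n k J, (s ++ l).idxOf X = s.idxOf X := fun X hX =>
    List.idxOf_append_of_mem (hs.mem_iff.2 hX)
  have hidx2 : ∀ X ∈ fullSet n k J, (s ++ l).idxOf X = s.length + l.idxOf X := fun X hX => by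
    rw [List.idxOf_append_of_notMem fun h1 => disjoint_sufSet_fullSet hJ (hs.mem_iff.1 h1) hX]
  refine ⟨isAdm_of_consistent_prefix (by omega) (realizable_sufSet_union_fullSet hJ) ?_ ?_ ?_, ?_⟩
  · rw [List.nodup_append]
    refine ⟨hs.nodup, hl, ?_⟩
    rintro A hA B hB rfl
    exact disjoint_sufSet_fullSet hJ (hs.mem_iff.1 hA) (hmem.1 hB)
  · rw [List.toFinset_append, hs.toFinset_eq, hlF]
  · intro m
    by_cases hm : m ≤ s.length
    · convert hs.consistent_prefix (realizable_sufSet hJ) m using 1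
      ext X
      rw [Finset.mem_filter, Finset.mem_filter, Finset.mem_union]
      constructor
      · rintro ⟨hX | hX, hlt⟩
        · exact ⟨hX, hidx1 X hX ▸ hlt⟩
        · rw [hidx2 X hX] at hlt
          omega
      · rintro ⟨hX, hlt⟩
        exact ⟨Or.inl hX, (hidx1 X hX).symm ▸ hlt⟩
    · convert h (m - s.length) using 1
      ext X
      rw [Finset.mem_filter, Finset.mem_union, Finset.mem_union, Finset.mem_filter]
      constructor
      · rintro ⟨hX | hX, hlt⟩
        · exact Or.inl hX
        · rw [hidx2 X hX] at hlt
          exact Or.inr ⟨hX, by omega⟩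
      · rintro (hX | ⟨hX, hlt⟩)
        · refine ⟨Or.inl hX, ?_⟩
          have := List.idxOf_lt_length_of_mem (hs.mem_iff.2 hX)
          rw [hidx1 X hX]
          omega
        · refine ⟨Or.inr hX, ?_⟩
          rw [hidx2 X hX]
          omega
  · intro A hA B hB
    have := List.idxOf_lt_length_of_mem (hs.mem_iff.2 hA)
    rw [hidx1 A hA, hidx2 B hB]
    omega

theorem extOrders_subset {n k : ℕ} {J : Finset (Finset (Fin n))} (hJ : Realizable n k J)
    {s : List (Finset (Fin n))} (hs : IsAdm n (k + 1) (sufSet n k J) s) :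
    extOrders n k J s ⊆ sufFirstOrders n k J := by
  rintro _ ⟨l, ⟨c, hc⟩, rfl⟩
  exact isAdm_append hJ hs hc.1 hc.2.1 (hc.consistent_prefix hJ)

/-- Deleting both the minimum and the maximum of `Z` gives the last entry of one proper suffix row
and the first entry of another: it would be outside `J` and inside `J`. -/
theorem fullSet_sufSet {n k : ℕ} {J : Finset (Finset (Fin n))} (hJ : Realizable n k J) :
    fullSet n (k + 1) (sufSet n k J) = ∅ := by
  rw [Finset.eq_empty_iff_forall_notMem]
  intro Z hZ
  obtain ⟨hZC, hZ⟩ := mem_fullSet.1 hZ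
  obtain ⟨m, hm, hmin⟩ := exists_min_mem (nonempty_of_mem_C hZC)
  obtain ⟨M, hM, hmax⟩ := exists_max_mem (nonempty_of_mem_C hZC)
  have hc : 1 < Z.card := by rw [mem_C.1 hZC]; omega
  have hmM : m ≠ M := by
    rintro rfl
    obtain ⟨z, hz, hzm⟩ := Finset.exists_mem_ne hc m
    exact (hmin z hz hzm).asymm (hmax z hz hzm)
  have hJc := (realizable_iff.1 hJ).2
  have h1 := (not_incAt_ends hJc ((mem_sufSet hJ).1 (hZ m hm))).2.2 M (by simp [hM, hmM.symm])
    fun z hz => hmax z (Finset.mem_of_mem_erase hz)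
  have h2 := (not_incAt_ends hJc ((mem_sufSet hJ).1 (hZ M hM))).2.1 m (by simp [hm, hmM])
    fun z hz => hmin z (Finset.mem_of_mem_erase hz)
  rw [Finset.erase_right_comm] at h2
  exact h1 h2

/-- With no full packets, the inversion set of an admissible `J_s`-order is always `(J_s)_s`, so `s`
and `s'` agree on every packet. -/
theorem proj_append_eq {n k : ℕ} {J : Finset (Finset (Fin n))} (hJ : Realizable n k J)
    {s s' l : List (Finset (Fin n))} (hs : IsAdm n (k + 1) (sufSet n k J) s)
    (hs' : IsAdm n (k + 1) (sufSet n k J) s')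
    (ρ ρ' : Adm n (k + 1) (sufSet n k J ∪ fullSet n k J)) (hρ : ρ.1 = s ++ l)
    (hρ' : ρ'.1 = s' ++ l) : proj ρ = proj ρ' := by
  refine proj_eq_of_filter_eq ρ ρ' fun X hX => ?_
  rw [hρ, hρ', List.filter_append, List.filter_append, hs.filter_eq (realizable_sufSet hJ) hX,
    hs'.filter_eq (realizable_sufSet hJ) hX]
  simp only [inv, fullSet_sufSet hJ, Finset.filter_empty]

theorem exists_append_of_mem_sufFirstOrders {n k : ℕ} {J : Finset (Finset (Fin n))}
    (hJ : Realizable n k J) {ρ : List (Finset (Fin n))} (hρ : ρ ∈ sufFirstOrders n k J) :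
    ∃ s t, ρ = s ++ t ∧ IsAdm n (k + 1) (sufSet n k J) s ∧ t.Nodup ∧
      t.toFinset = fullSet n k J ∧
      ∀ m, Consistent (sufSet n k J ∪ (fullSet n k J).filter fun X => t.idxOf X < m) := by
  obtain ⟨hρ, hlt⟩ := hρ
  have hL := realizable_sufSet_union_fullSet hJ
  have hpre : ρ.filter (· ∈ sufSet n k J) <+: ρ := by
    rw [filter_prefix_iff, pairwise_iff_idxOf hρ.nodup]
    intro A hA B hB hAB hBs
    rw [decide_eq_true_eq] at hBs ⊢
    by_contra hAs
    exact hAB.asymm (hlt B hBs A ((Finset.mem_union.1 (hρ.mem_iff.1 hA)).resolve_left hAs))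
  obtain ⟨t, ht⟩ := hpre
  have hsm : ∀ A, A ∈ ρ.filter (· ∈ sufSet n k J) ↔ A ∈ sufSet n k J := fun A => by
    rw [List.mem_filter, hρ.mem_iff, decide_eq_true_eq]
    exact ⟨fun h => h.2, fun h => ⟨Finset.mem_union_left _ h, h⟩⟩
  generalize ρ.filter (· ∈ sufSet n k J) = s at ht hsm
  subst ht
  obtain ⟨hsn, htn, hst⟩ := List.nodup_append.1 hρ.nodup
  have htm : ∀ A, A ∈ t ↔ A ∈ fullSet n k J := fun A => by
    have h1 := hρ.mem_iff (A := A)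
    rw [List.mem_append, hsm, Finset.mem_union] at h1
    constructor
    · intro hA
      refine (h1.1 (Or.inr hA)).resolve_left fun h => hst A ((hsm A).2 h) A hA rfl
    · intro hA
      exact (h1.2 (Or.inr hA)).resolve_left fun h => disjoint_sufSet_fullSet hJ h hA
  have hidx1 : ∀ X ∈ sufSet n k J, (s ++ t).idxOf X = s.idxOf X := fun X hX =>
    List.idxOf_append_of_mem ((hsm X).2 hX)
  have hidx2 : ∀ X ∈ fullSet n k J, (s ++ t).idxOf X = s.length + t.idxOf X := fun X hX => by
    rw [List.idxOf_append_of_notMem fun h1 => disjoint_sufSet_fullSet hJ ((hsm X).1 h1) hX]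
  have hlen : ∀ X ∈ sufSet n k J, s.idxOf X < s.length := fun X hX =>
    List.idxOf_lt_length_of_mem ((hsm X).2 hX)
  refine ⟨s, t, rfl, isAdm_of_consistent_prefix (by omega) (realizable_sufSet hJ) hsn ?_ ?_, htn,
    ?_, ?_⟩
  · ext A
    rw [List.mem_toFinset, hsm]
  · intro m
    -- Truncating at `s.length` keeps elements of `J_F` out of the segment.
    convert hρ.consistent_prefix hL (min m s.length) using 1
    ext X
    rw [Finset.mem_filter, Finset.mem_filter, Finset.mem_union, lt_min_iff]
    constructor
    · rintro ⟨hX, h⟩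
      rw [hidx1 X hX]
      exact ⟨Or.inl hX, h, hlen X hX⟩
    · rintro ⟨hX | hX, h⟩
      · rw [hidx1 X hX] at h
        exact ⟨hX, h.1⟩
      · rw [hidx2 X hX] at h
        omega
  · ext A
    rw [List.mem_toFinset, htm]
  · intro m
    convert hρ.consistent_prefix hL (s.length + m) using 1
    ext X
    rw [Finset.mem_filter, Finset.mem_union, Finset.mem_union, Finset.mem_filter]
    constructor
    · rintro (hX | ⟨hX, h⟩)
      · have := hlen X hX
        exact ⟨Or.inl hX, by rw [hidx1 X hX]; omega⟩
      · exact ⟨Or.inr hX, by rw [hidx2 X hX]; omega⟩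
    · rintro ⟨hX | hX, h⟩
      · exact Or.inl hX
      · rw [hidx2 X hX] at h
        exact Or.inr ⟨hX, by omega⟩

/-- The sets obtained from the initial segments of `t` are inversion sets of classes `r m`, each a
flip above the previous one until `t` is exhausted. -/
theorem mem_chainOrders_of_consistent {n k : ℕ} {J : Finset (Finset (Fin n))} (hk : 1 ≤ k)
    (hJ : Realizable n k J) {t : List (Finset (Fin n))} (ht : t.Nodup)
    (htF : t.toFinset = fullSet n k J)
    (h : ∀ m, Consistent (sufSet n k J ∪ (fullSet n k J).filter fun X => t.idxOf X < m)) :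
    t ∈ chainOrders n k J := by
  have hmem : ∀ {X}, X ∈ t ↔ X ∈ fullSet n k J := fun {X} => by rw [← htF, List.mem_toFinset]
  have hex : ∀ m, ∃ r : SecondBruhat n k J,
      r.inv = sufSet n k J ∪ (fullSet n k J).filter fun X => t.idxOf X < m := fun m =>
    Between.exists_inv_eq ⟨Finset.subset_union_left,
      Finset.union_subset_union_right (Finset.filter_subset _ _)⟩ hk hJ (h m)
  choose r hr using hex
  have hmr : ∀ m, ∀ X ∈ fullSet n k J, (X ∈ (r m).inv ↔ t.idxOf X < m) := by
    intro m X hX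
    rw [hr, Finset.mem_union, Finset.mem_filter]
    constructor
    · rintro (h1 | h1)
      · exact (disjoint_sufSet_fullSet hJ h1 hX).elim
      · exact h1.2
    · exact fun h1 => Or.inr ⟨hX, h1⟩
  have hstep : ∀ m (hm : m < t.length), t[m] ∈ fullSet n k J ∧ t[m] ∉ (r m).inv ∧
      (r (m + 1)).inv = insert t[m] (r m).inv := by
    intro m hm
    have hF := hmem.1 (List.getElem_mem hm)
    refine ⟨hF, by rw [hmr m _ hF, ht.idxOf_getElem]; exact lt_irrefl _, ?_⟩
    ext X
    rw [Finset.mem_insert, hr, hr, Finset.mem_union, Finset.mem_union, Finset.mem_filter,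
      Finset.mem_filter]
    have h1 : ∀ hX : X ∈ fullSet n k J, t.idxOf X = m → X = t[m] := fun hX he => by
      subst he
      simp
    have h2 : X = t[m] → X ∈ fullSet n k J ∧ t.idxOf X = m := by
      rintro rfl
      exact ⟨hF, ht.idxOf_getElem _ _⟩
    constructor
    · rintro (h3 | ⟨h3, h4⟩)
      · exact Or.inr (Or.inl h3)
      · rcases (Nat.lt_succ_iff_lt_or_eq.1 h4) with h5 | h5
        · exact Or.inr (Or.inr ⟨h3, h5⟩)
        · exact Or.inl (h1 h3 h5)
    · rintro (h3 | h3 | ⟨h3, h4⟩)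
      · obtain ⟨h4, h5⟩ := h2 h3
        exact Or.inr ⟨h4, by omega⟩
      · exact Or.inl h3
      · exact Or.inr ⟨h3, by omega⟩
  have hmono : Monotone r := monotone_nat_of_le_succ fun m => by
    by_cases hm : m < t.length
    · exact ((flipUp_iff hk hJ).2 ⟨_, hstep m hm⟩).le
    · refine (inv_injective hJ ?_).le
      rw [hr, hr]
      congr 1
      refine Finset.filter_congr fun X hX => ?_
      have := List.idxOf_lt_length_of_mem (hmem.2 hX)
      omega
  have hcard : ∀ m ≤ t.length, (r m).inv.card = (sufSet n k J).card + m := by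
    intro m
    induction m with
    | zero =>
      intro _
      rw [hr]
      simp
    | succ m ih =>
      intro hm
      obtain ⟨-, h1, h2⟩ := hstep m (by omega)
      rw [h2, Finset.card_insert_of_notMem h1, ih (by omega)]
      omega
  have hchain : IsChain (· ≤ ·) (Set.range r) := by
    rintro _ ⟨i, rfl⟩ _ ⟨j, rfl⟩ -
    exact (le_total i j).imp (fun h => hmono h) fun h => hmono h
  -- Maximality: the inversion sets `(r m).inv` take every cardinality from that of `J_s` to that of
  -- `J_s ∪ J_F`, so an element of a larger chain is comparable to an `r m` of equal size and hence
  -- equal to it.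
  refine ⟨⟨Set.range r, hchain, fun {s} hs hrs => hrs.antisymm fun x hx => ?_⟩, ht, htF, ?_⟩
  · have h1 := Finset.card_le_card x.between.le
    have h2 : x.inv.card ≤ (r t.length).inv.card := Finset.card_le_card fun X hX => by
      rw [hr, Finset.mem_union, Finset.mem_filter]
      exact (Finset.mem_union.1 (x.between.ge hX)).imp id fun h =>
        ⟨h, List.idxOf_lt_length_of_mem (hmem.2 h)⟩
    rw [hcard _ le_rfl] at h2
    have h3 := hcard (x.inv.card - (sufSet n k J).card) (by omega)
    refine ⟨x.inv.card - (sufSet n k J).card, inv_injective hJ ?_⟩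
    rcases hs.total (hrs ⟨x.inv.card - (sufSet n k J).card, rfl⟩) hx with h4 | h4
    · exact Finset.eq_of_subset_of_card_le (inv_subset_of_le h4) (by omega)
    · exact (Finset.eq_of_subset_of_card_le (inv_subset_of_le h4) (by omega)).symm
  · intro X hX Y hY
    constructor
    · intro hlt
      exact ⟨r (t.idxOf Y), ⟨_, rfl⟩, (hmr _ X hX).2 hlt, fun h1 => lt_irrefl _ ((hmr _ Y hY).1 h1)⟩
    · rintro ⟨_, ⟨m, rfl⟩, h1, h2⟩
      rw [hmr m X hX] at h1
      rw [hmr m Y hY] at h2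
      omega

theorem classes_extOrders {n k : ℕ} {J : Finset (Finset (Fin n))} (hk : 1 ≤ k)
    (hJ : Realizable n k J) {s : List (Finset (Fin n))}
    (hs : IsAdm n (k + 1) (sufSet n k J) s) :
    classes n (k + 1) (sufSet n k J ∪ fullSet n k J) (extOrders n k J s) = thirdBruhat n k J := by
  ext x
  constructor
  · rintro ⟨ρ, hρ, rfl⟩
    exact ⟨ρ, extOrders_subset hJ hs hρ, rfl⟩
  · rintro ⟨ρ, hρ, rfl⟩
    obtain ⟨s', t, he, hs', ht, htF, htc⟩ := exists_append_of_mem_sufFirstOrders hJ hρ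
    have hadm := (isAdm_append hJ hs ht htF htc).1
    exact ⟨⟨s ++ t, hadm⟩, ⟨t, mem_chainOrders_of_consistent hk hJ ht htF htc, rfl⟩,
      proj_append_eq hJ hs hs' _ _ rfl he⟩

end HigherBruhat

theorem mainTheorem9 (n k : ℕ) (hk : 2 ≤ k) (J : Finset (Finset (Fin n)))
    (hJ : HigherBruhat.Realizable n k J) :
    -- `J_s` and `J_s ∪ J_F` are realizable, and an admissible `J_s`-order exists
    HigherBruhat.Realizable n (k + 1) (HigherBruhat.sufSet n k J) ∧
    HigherBruhat.Realizable n (k + 1)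
      (HigherBruhat.sufSet n k J ∪ HigherBruhat.fullSet n k J) ∧
    (∃ ρs, HigherBruhat.IsAdm n (k + 1) (HigherBruhat.sufSet n k J) ρs) ∧
    -- every maximal chain of the second Bruhat order of `J` gives exactly one total order on `J_F`
    (∀ c : Flag (HigherBruhat.SecondBruhat n k J), ∃! l, HigherBruhat.Induces c l) ∧
    -- the extended orders are admissible and place `J_s` before `J_F`
    (∀ ρs, HigherBruhat.IsAdm n (k + 1) (HigherBruhat.sufSet n k J) ρs →
      HigherBruhat.extOrders n k J ρs ⊆ HigherBruhat.sufFirstOrders n k J) ∧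
    -- the class of each extended order does not depend on the admissible `J_s`-order
    (∀ ρs ρs', HigherBruhat.IsAdm n (k + 1) (HigherBruhat.sufSet n k J) ρs →
      HigherBruhat.IsAdm n (k + 1) (HigherBruhat.sufSet n k J) ρs' →
      ∀ l ∈ HigherBruhat.chainOrders n k J,
      ∀ ρ ρ' : HigherBruhat.Adm n (k + 1)
        (HigherBruhat.sufSet n k J ∪ HigherBruhat.fullSet n k J),
      ρ.1 = ρs ++ l → ρ'.1 = ρs' ++ l → HigherBruhat.proj ρ = HigherBruhat.proj ρ') ∧
    -- the set of classes of extended orders does not depend on it either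
    (∀ ρs ρs', HigherBruhat.IsAdm n (k + 1) (HigherBruhat.sufSet n k J) ρs →
      HigherBruhat.IsAdm n (k + 1) (HigherBruhat.sufSet n k J) ρs' →
      HigherBruhat.classes n (k + 1) (HigherBruhat.sufSet n k J ∪ HigherBruhat.fullSet n k J)
        (HigherBruhat.extOrders n k J ρs) =
      HigherBruhat.classes n (k + 1) (HigherBruhat.sufSet n k J ∪ HigherBruhat.fullSet n k J)
        (HigherBruhat.extOrders n k J ρs')) ∧
    -- and it equals the third Bruhat order of `J`
    (∀ ρs, HigherBruhat.IsAdm n (k + 1) (HigherBruhat.sufSet n k J) ρs →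
      HigherBruhat.classes n (k + 1) (HigherBruhat.sufSet n k J ∪ HigherBruhat.fullSet n k J)
        (HigherBruhat.extOrders n k J ρs) =
      HigherBruhat.thirdBruhat n k J) := by
  have hk1 : 1 ≤ k := by omega
  refine ⟨HigherBruhat.realizable_sufSet hJ, HigherBruhat.realizable_sufSet_union_fullSet hJ, ?_,
    HigherBruhat.existsUnique_induces hk1 hJ, fun ρs hs => HigherBruhat.extOrders_subset hJ hs,
    fun ρs ρs' hs hs' l _ ρ ρ' => HigherBruhat.proj_append_eq hJ hs hs' ρ ρ',
    fun ρs ρs' hs hs' => (HigherBruhat.classes_extOrders hk1 hJ hs).trans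
      (HigherBruhat.classes_extOrders hk1 hJ hs').symm,
    fun ρs hs => HigherBruhat.classes_extOrders hk1 hJ hs⟩
  have hK := HigherBruhat.realizable_sufSet hJ
  -- The only possible inversion set of a `J_s`-order is `(J_s)_s`; it is consistent by applying
  -- `realizable_sufSet` a second time.
  obtain ⟨ρ, hρ, -⟩ := HigherBruhat.Between.exists_isAdm
    (I := HigherBruhat.sufSet n (k + 1) (HigherBruhat.sufSet n k J))
    ⟨subset_rfl, Finset.subset_union_left⟩ (by omega) hK
    (HigherBruhat.realizable_iff.1 (HigherBruhat.realizable_sufSet hK)).2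
  exact ⟨ρ, hρ⟩
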